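/- Let $E$ be an odd symplectic supermanifold of dimension $(n.n)$, possibly depending on $q\ge 0$ external odd parameters $\eta_1,\dots,\eta_q$: a space $M$ (Hausdorff, second countable) with a sheaf of $\mathbb Z/2$-graded $\mathbb R$-algebras locally isomorphic to $C^\infty(V)\otimes\Lambda(\theta_1,\dots,\theta_n,\eta_1,\dots,\eta_q)$, $V\subset\mathbb R^n$ open (the isomorphisms, i.e. the local coordinate systems $z=(x^1,\dots,x^n;\theta_1,\dots,\theta_n)$, respect parity and the $\eta_a$), endowed with a non-degenerate odd Poisson bracket $\{\,,\,\}$ with $\{\eta_a,\cdot\}=0$. Local coordinates $(x,\theta)$ are Darboux coordinates if $\{x^i,x^j\}=0$, $\{\theta_i,\theta_j\}=0$, $\{x^i,\theta_j\}=\delta^i_j$; in such coordinates put $\Delta_0 s=\sum_i\frac{\partial^2 s}{\partial x^i\partial\theta_i}$ (left derivatives). A semidensity $\boldsymbol s=s(x,\theta)\sqrt{D(x,\theta)}$ on $E$ is given by a coefficient function $s$ in each Darboux coordinate system, such that under a change of Darboux coordinates $s'=s\cdot\left(\mathrm{Ber}\,\frac{\partial(x,\theta)}{\partial(x',\theta')}\right)^{1/2}$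 on the common domain. 1. Let $(x,\theta)$ and $(x',\theta')$ be two Darboux coordinate systems, both defined on an open set $U$, and let $\Delta_0,\Delta_0'$ be the corresponding operators. Then $\mathrm{Ber}\,\frac{\partial(x,\theta)}{\partial(x',\theta')}$ has exactly one even square root on $U$ with everywhere positive body, denoted $\left(\mathrm{Ber}\,\frac{\partial(x,\theta)}{\partial(x',\theta')}\right)^{1/2}$, and for every function $s$ on $U$ $$\left(\Delta_0 s\right)\cdot\left(\mathrm{Ber}\,\frac{\partial(x,\theta)}{\partial(x',\theta')}\right)^{1/2}=\Delta_0'\left(s\cdot\left(\mathrm{Ber}\,\frac{\partial(x,\theta)}{\partial(x',\theta')}\right)^{1/2}\right).$$ 2. Consequently there is exactly one operator $\Delta$ from semidensities on $E$ to semidensities on $E$ such that, in every Darboux coordinate system, $\Delta\left(s\sqrt{D(x,\theta)}\right)=\frac{\partial^2 s}{\partial x^i\partial\theta_i}\sqrt{D(x,\theta)}$ (summation over $i$). It is linear, and $\Delta^2=0$. -/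

import Mathlib

open TopologicalSpace
open scoped TensorProduct ContDiff

universe u v

noncomputable section

namespace OddSymp

/-! ### Superdomains -/

/-- The algebra `C^∞(V)` of smooth real functions on an open subset `V` of `ℝⁿ`. -/
def smoothFun {n : ℕ} (V : Opens (Fin n → ℝ)) : Subalgebra ℝ (V → ℝ) where
  carrier := {f | ∀ x : V, ContDiffAt ℝ ∞ (Function.extend Subtype.val f 0) (x : Fin n → ℝ)}
  mul_mem' := by
    intro f g hf hg x
    have h : Function.extend Subtype.val (f * g) (0 : (Fin n → ℝ) → ℝ) =
        Function.extend Subtype.val f 0 * Function.extend Subtype.val g 0 := by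
      simpa using Function.extend_mul (Subtype.val : V → Fin n → ℝ) f g 0 0
    rw [h]
    exact (hf x).mul (hg x)
  add_mem' := by
    intro f g hf hg x
    have h : Function.extend Subtype.val (f + g) (0 : (Fin n → ℝ) → ℝ) =
        Function.extend Subtype.val f 0 + Function.extend Subtype.val g 0 := by
      simpa using Function.extend_add (Subtype.val : V → Fin n → ℝ) f g 0 0
    rw [h]
    exact (hf x).add (hg x)
  algebraMap_mem' := by
    intro r x
    refine (contDiffAt_const (c := r)).congr_of_eventuallyEq ?_
    filter_upwards [V.isOpen.mem_nhds x.2] with y hy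
    exact Subtype.val_injective.extend_apply _ _ (⟨y, hy⟩ : V)

theorem extend_apply {n : ℕ} {V : Opens (Fin n → ℝ)} (f : V → ℝ) {y : Fin n → ℝ} (hy : y ∈ V) :
    Function.extend Subtype.val f 0 y = f ⟨y, hy⟩ :=
  Subtype.val_injective.extend_apply f 0 (⟨y, hy⟩ : V)

/-- Restriction of smooth functions to a smaller open set. -/
def smoothRes {n : ℕ} {V W : Opens (Fin n → ℝ)} (h : W ≤ V) : smoothFun V →ₐ[ℝ] smoothFun W where
  toFun f := ⟨fun x => (f : V → ℝ) ⟨x, h x.2⟩, by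
    intro x
    refine (f.2 ⟨x, h x.2⟩).congr_of_eventuallyEq ?_
    filter_upwards [W.isOpen.mem_nhds x.2] with y hy
    rw [extend_apply _ hy, extend_apply _ (h hy)]⟩
  map_one' := rfl
  map_mul' _ _ := rfl
  map_zero' := rfl
  map_add' _ _ := rfl
  commutes' _ := rfl

/-- The `i`-th partial derivative of smooth functions on `V`. -/
def smoothDeriv {n : ℕ} (V : Opens (Fin n → ℝ)) (i : Fin n) : smoothFun V →ₗ[ℝ] smoothFun V where
  toFun f := ⟨fun x => fderiv ℝ (Function.extend Subtype.val (f : V → ℝ) 0) x (Pi.single i 1), by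
    intro x
    have h : ContDiffAt ℝ ∞
        (fun y => fderiv ℝ (Function.extend Subtype.val (f : V → ℝ) 0) y (Pi.single i 1))
        (x : Fin n → ℝ) :=
      ((f.2 x).fderiv_right (m := ∞) le_rfl).clm_apply contDiffAt_const
    refine h.congr_of_eventuallyEq ?_
    filter_upwards [V.isOpen.mem_nhds x.2] with y hy
    rw [extend_apply _ hy]⟩
  map_add' f g := by
    ext x
    have hf := (f.2 x).differentiableAt (by simp)
    have hg := (g.2 x).differentiableAt (by simp)
    have h : Function.extend Subtype.val ((f + g : smoothFun V) : V → ℝ) (0 : (Fin n → ℝ) → ℝ) =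
        Function.extend Subtype.val (f : V → ℝ) 0 + Function.extend Subtype.val (g : V → ℝ) 0 := by
      simpa using Function.extend_add (Subtype.val : V → Fin n → ℝ) (f : V → ℝ) (g : V → ℝ) 0 0
    simp only [h, fderiv_add hf hg]
    rfl
  map_smul' r f := by
    ext x
    have hf := (f.2 x).differentiableAt (by simp)
    have h : Function.extend Subtype.val ((r • f : smoothFun V) : V → ℝ) (0 : (Fin n → ℝ) → ℝ) =
        r • Function.extend Subtype.val (f : V → ℝ) 0 := by
      simpa using Function.extend_smul r (Subtype.val : V → Fin n → ℝ) (f : V → ℝ) 0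
    simp only [h, fderiv_const_smul hf]
    rfl

/-- The coordinate function `xⁱ` on `V`. -/
def smoothCoord {n : ℕ} (V : Opens (Fin n → ℝ)) (i : Fin n) : smoothFun V :=
  ⟨fun x => (x : Fin n → ℝ) i, by
    intro x
    refine (contDiff_apply ℝ ℝ i).contDiffAt.congr_of_eventuallyEq ?_
    filter_upwards [V.isOpen.mem_nhds x.2] with y hy
    exact extend_apply _ hy⟩

/-- The real Grassmann algebra with generators `θ₁, …, θₙ` (indices `Sum.inl i`) and the external
odd parameters `η₁, …, η_q` (indices `Sum.inr a`). -/
abbrev Grass (n q : ℕ) : Type := ExteriorAlgebra ℝ (Fin n ⊕ Fin q → ℝ)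

/-- The generator of the Grassmann algebra with index `k`. -/
def Grass.gen {n q : ℕ} (k : Fin n ⊕ Fin q) : Grass n q := ExteriorAlgebra.ι ℝ (Pi.single k 1)

/-- The algebra of functions of `x ∈ V`, `θ₁, …, θₙ` and the odd parameters `η₁, …, η_q`:
`C^∞(V) ⊗ Λ(θ, η)`. -/
abbrev SuperFun {n : ℕ} (q : ℕ) (V : Opens (Fin n → ℝ)) : Type := smoothFun V ⊗[ℝ] Grass n q

namespace SuperFun

variable {n q : ℕ}

/-- Restriction to a smaller open set. -/
def res {V W : Opens (Fin n → ℝ)} (h : W ≤ V) : SuperFun q V →ₐ[ℝ] SuperFun q W :=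
  Algebra.TensorProduct.map (smoothRes h) (AlgHom.id ℝ _)

/-- The parity involution: `f ↦ f` on even and `f ↦ -f` on odd functions. -/
def par (V : Opens (Fin n → ℝ)) : SuperFun q V →ₐ[ℝ] SuperFun q V :=
  Algebra.TensorProduct.map (AlgHom.id ℝ _) CliffordAlgebra.involute

/-- The body of a function: its value at `θ = 0`, `η = 0`. -/
def body (V : Opens (Fin n → ℝ)) : SuperFun q V →ₐ[ℝ] smoothFun V :=
  (Algebra.TensorProduct.rid ℝ ℝ (smoothFun V)).toAlgHom.comp
    (Algebra.TensorProduct.map (AlgHom.id ℝ _) ExteriorAlgebra.algebraMapInv)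

/-- The even coordinate `xⁱ`. -/
def x (V : Opens (Fin n → ℝ)) (i : Fin n) : SuperFun q V := smoothCoord V i ⊗ₜ 1

/-- The odd coordinate `θᵢ`. -/
def θ (V : Opens (Fin n → ℝ)) (i : Fin n) : SuperFun q V := 1 ⊗ₜ Grass.gen (Sum.inl i)

/-- The odd parameter `ηₐ`. -/
def η (V : Opens (Fin n → ℝ)) (a : Fin q) : SuperFun q V := 1 ⊗ₜ Grass.gen (Sum.inr a)

/-- The partial derivative `∂/∂xⁱ`. -/
def dx (V : Opens (Fin n → ℝ)) (i : Fin n) : SuperFun q V →ₗ[ℝ] SuperFun q V :=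
  TensorProduct.map (smoothDeriv V i) LinearMap.id

/-- The (left) partial derivative `∂/∂θᵢ`. -/
def dθ (V : Opens (Fin n → ℝ)) (i : Fin n) : SuperFun q V →ₗ[ℝ] SuperFun q V :=
  TensorProduct.map LinearMap.id
    (CliffordAlgebra.contractLeft (LinearMap.proj (Sum.inl i) : (Fin n ⊕ Fin q → ℝ) →ₗ[ℝ] ℝ))

end SuperFun

/-! ### The Berezinian -/

/-- The determinant by the Leibniz formula. It is used for matrices whose entries are even and
therefore commute, although they lie in a non-commutative ring. -/
def ldet {R : Type*} [Ring R] {n : ℕ} (A : Matrix (Fin n) (Fin n) R) : R :=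
  ∑ σ : Equiv.Perm (Fin n), ((Equiv.Perm.sign σ : ℤˣ) : ℤ) • (List.ofFn fun i => A (σ i) i).prod

/-- The Berezinian of the supermatrix with blocks `A`, `B`, `C`, `D`:
`Ber = det (A - B D⁻¹ C) / det D`. -/
def ber {R : Type*} [Ring R] {n : ℕ} (A B C D : Matrix (Fin n) (Fin n) R) : R :=
  ldet (A - B * Ring.inverse D * C) * Ring.inverse (ldet D)

/-! ### Supermanifolds -/

/-- A topological space `M` with a sheaf of associative real algebras, endowed with a parity
involution and with `q` distinguished elements, the external odd parameters. -/
structure SuperSpace (q : ℕ) (M : Type u) [TopologicalSpace M] where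
  /-- The functions on an open subset. -/
  sec : Opens M → Type v
  [ring : ∀ U, Ring (sec U)]
  [algebra : ∀ U, Algebra ℝ (sec U)]
  /-- Restriction of functions. -/
  res : ∀ {U W : Opens M}, W ≤ U → (sec U →ₐ[ℝ] sec W)
  res_self : ∀ (U : Opens M) (f : sec U), res le_rfl f = f
  res_res : ∀ {U W Z : Opens M} (h : W ≤ U) (k : Z ≤ W) (f : sec U),
    res k (res h f) = res (k.trans h) f
  existsUnique_glue : ∀ {ι : Type u} (W : ι → Opens M) (s : ∀ i, sec (W i)),
    (∀ i j, res (inf_le_left : W i ⊓ W j ≤ W i) (s i) =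
      res (inf_le_right : W i ⊓ W j ≤ W j) (s j)) →
    ∃! t : sec (iSup W), ∀ i, res (le_iSup W i) t = s i
  /-- The parity involution. -/
  par : ∀ U, sec U →ₐ[ℝ] sec U
  par_res : ∀ {U W : Opens M} (h : W ≤ U) (f : sec U), par W (res h f) = res h (par U f)
  /-- The external odd parameters. -/
  η : ∀ U, Fin q → sec U
  η_res : ∀ {U W : Opens M} (h : W ≤ U) (a : Fin q), res h (η U a) = η W a

attribute [instance] SuperSpace.ring SuperSpace.algebra

variable {q : ℕ} {M : Type u} [TopologicalSpace M]

/-- `f` is homogeneous of parity `p` (modulo 2). -/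
def SuperSpace.IsHomog (X : SuperSpace.{u, v} q M) {U : Opens M} (p : ℕ) (f : X.sec U) : Prop :=
  X.par U f = (-1) ^ p * f

/-- The image of (the part in the source of) an open set under a partial homeomorphism. -/
def imageOpens {n : ℕ} (e : OpenPartialHomeomorph M (Fin n → ℝ)) (U : Opens M) :
    Opens (Fin n → ℝ) :=
  ⟨e '' (e.source ∩ U), e.isOpen_image_source_inter U.isOpen⟩

theorem imageOpens_mono {n : ℕ} (e : OpenPartialHomeomorph M (Fin n → ℝ)) {U W : Opens M}
    (h : W ≤ U) : imageOpens e W ≤ imageOpens e U :=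
  Set.image_mono (Set.inter_subset_inter_right _ h)

/-- A local coordinate system `(x¹, …, xⁿ; θ₁, …, θₙ)` on an open subset `dom` of `X`: an
isomorphism of `dom`, with its sheaf of functions, parity and odd parameters, onto an open
`(n.n)`-dimensional superdomain. -/
structure Chart (n : ℕ) (X : SuperSpace.{u, v} q M) where
  /-- The homeomorphism of the underlying spaces. -/
  homeo : OpenPartialHomeomorph M (Fin n → ℝ)
  /-- The isomorphism of the algebras of functions. -/
  iso : ∀ U : Opens M, (U : Set M) ⊆ homeo.source → (X.sec U ≃ₐ[ℝ] SuperFun q (imageOpens homeo U))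
  iso_res : ∀ (U W : Opens M) (hU : (U : Set M) ⊆ homeo.source) (h : W ≤ U) (f : X.sec U),
    iso W (Set.Subset.trans h hU) (X.res h f) =
      SuperFun.res (imageOpens_mono homeo h) (iso U hU f)
  iso_par : ∀ (U : Opens M) (hU : (U : Set M) ⊆ homeo.source) (f : X.sec U),
    iso U hU (X.par U f) = SuperFun.par _ (iso U hU f)
  iso_η : ∀ (U : Opens M) (hU : (U : Set M) ⊆ homeo.source) (a : Fin q),
    iso U hU (X.η U a) = SuperFun.η _ a

namespace Chart

variable {n : ℕ} {X : SuperSpace.{u, v} q M}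

/-- The domain of the coordinate system. -/
def dom (c : Chart n X) : Opens M := ⟨c.homeo.source, c.homeo.open_source⟩

/-- The even coordinate `xⁱ`, restricted to `U`. -/
def x (c : Chart n X) {U : Opens M} (h : U ≤ c.dom) (i : Fin n) : X.sec U :=
  (c.iso U h).symm (SuperFun.x _ i)

/-- The odd coordinate `θᵢ`, restricted to `U`. -/
def θ (c : Chart n X) {U : Opens M} (h : U ≤ c.dom) (i : Fin n) : X.sec U :=
  (c.iso U h).symm (SuperFun.θ _ i)

/-- All coordinates `z = (x, θ)`, restricted to `U`. -/
def z (c : Chart n X) {U : Opens M} (h : U ≤ c.dom) : Fin n ⊕ Fin n → X.sec U :=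
  Sum.elim (c.x h) (c.θ h)

/-- The partial derivative `∂/∂xⁱ` of functions on `U` in the given coordinates. -/
def dx (c : Chart n X) {U : Opens M} (h : U ≤ c.dom) (i : Fin n) : X.sec U →ₗ[ℝ] X.sec U :=
  (c.iso U h).symm.toLinearMap ∘ₗ SuperFun.dx _ i ∘ₗ (c.iso U h).toLinearMap

/-- The partial derivative `∂/∂θᵢ` of functions on `U` in the given coordinates. -/
def dθ (c : Chart n X) {U : Opens M} (h : U ≤ c.dom) (i : Fin n) : X.sec U →ₗ[ℝ] X.sec U :=
  (c.iso U h).symm.toLinearMap ∘ₗ SuperFun.dθ _ i ∘ₗ (c.iso U h).toLinearMap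

/-- The coordinate odd Laplacian `Δ₀ s = ∑ᵢ ∂²s / ∂xⁱ ∂θᵢ`. -/
def lap (c : Chart n X) {U : Opens M} (h : U ≤ c.dom) : X.sec U →ₗ[ℝ] X.sec U :=
  ∑ i, c.dx h i ∘ₗ c.dθ h i

/-- The Berezinian `Ber ∂(x, θ) / ∂(x', θ')` on `U`, where `(x, θ)` are the coordinates of `c` and
`(x', θ')` those of `c'`. Rows are indexed by the variables of differentiation. -/
def jacBer (c c' : Chart n X) {U : Opens M} (h : U ≤ c.dom) (h' : U ≤ c'.dom) : X.sec U :=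
  ber (Matrix.of fun i j => c'.dx h' i (c.x h j)) (Matrix.of fun i j => c'.dx h' i (c.θ h j))
    (Matrix.of fun i j => c'.dθ h' i (c.x h j)) (Matrix.of fun i j => c'.dθ h' i (c.θ h j))

/-- `f` is an even function on `U` whose body is positive everywhere on `U`. -/
def IsPos (c : Chart n X) {U : Opens M} (h : U ≤ c.dom) (f : X.sec U) : Prop :=
  X.IsHomog 0 f ∧ ∀ p, 0 < (SuperFun.body _ (c.iso U h f) : imageOpens c.homeo U → ℝ) p

/-- `r` is a positive square root of the Berezinian `Ber ∂(x, θ) / ∂(x', θ')` on `U`. -/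
def IsSqrtBer (c c' : Chart n X) {U : Opens M} (h : U ≤ c.dom) (h' : U ≤ c'.dom)
    (r : X.sec U) : Prop :=
  c.IsPos h r ∧ r * r = c.jacBer c' h h'

/-- The function `(Ber ∂(x, θ) / ∂(x', θ'))^{1/2}` on `U`: the positive square root
(meaningful when there is exactly one). -/
def sqrtBer (c c' : Chart n X) {U : Opens M} (h : U ≤ c.dom) (h' : U ≤ c'.dom) : X.sec U :=
  Classical.epsilon (c.IsSqrtBer c' h h')

end Chart

/-- An odd symplectic supermanifold of dimension `(n.n)`, possibly depending on `q` external odd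
parameters: a supermanifold with a non-degenerate odd Poisson bracket of functions. -/
structure OddSymplecticSupermanifold (n q : ℕ) (M : Type u) [TopologicalSpace M] extends
    SuperSpace.{u, v} q M where
  exists_chart : ∀ p : M, ∃ c : Chart n toSuperSpace, p ∈ c.dom
  /-- The odd Poisson bracket. -/
  br : ∀ U, sec U →ₗ[ℝ] sec U →ₗ[ℝ] sec U
  br_res : ∀ {U W : Opens M} (h : W ≤ U) (f g : sec U), res h (br U f g) = br W (res h f) (res h g)
  br_homog : ∀ {U : Opens M} (a b : ℕ) (f g : sec U), toSuperSpace.IsHomog a f →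
    toSuperSpace.IsHomog b g → toSuperSpace.IsHomog (a + b + 1) (br U f g)
  br_skew : ∀ {U : Opens M} (a b : ℕ) (f g : sec U), toSuperSpace.IsHomog a f →
    toSuperSpace.IsHomog b g → br U f g = -((-1) ^ ((a + 1) * (b + 1)) * br U g f)
  br_leibniz : ∀ {U : Opens M} (a b c : ℕ) (f g h : sec U), toSuperSpace.IsHomog a f →
    toSuperSpace.IsHomog b g → toSuperSpace.IsHomog c h →
    br U f (g * h) = br U f g * h + (-1) ^ (b * c) * (br U f h * g)
  br_jacobi : ∀ {U : Opens M} (a b c : ℕ) (f g h : sec U), toSuperSpace.IsHomog a f →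
    toSuperSpace.IsHomog b g → toSuperSpace.IsHomog c h →
    (-1) ^ ((a + 1) * (c + 1)) * br U f (br U g h) +
      (-1) ^ ((b + 1) * (a + 1)) * br U g (br U h f) +
      (-1) ^ ((c + 1) * (b + 1)) * br U h (br U f g) = 0
  br_η : ∀ (U : Opens M) (a : Fin q) (f : sec U), br U (η U a) f = 0
  br_nondegenerate : ∀ c : Chart n toSuperSpace,
    IsUnit (Matrix.of fun A B => br c.dom (c.z le_rfl A) (c.z le_rfl B))

/-- Darboux coordinates: `{xⁱ, xʲ} = 0`, `{θᵢ, θⱼ} = 0` and `{xⁱ, θⱼ} = δⁱⱼ`. -/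
structure DarbouxChart {n : ℕ} (E : OddSymplecticSupermanifold.{u, v} n q M) extends
    Chart n E.toSuperSpace where
  br_x_x : ∀ i j, E.br toChart.dom (toChart.x le_rfl i) (toChart.x le_rfl j) = 0
  br_θ_θ : ∀ i j, E.br toChart.dom (toChart.θ le_rfl i) (toChart.θ le_rfl j) = 0
  br_x_θ : ∀ i j, E.br toChart.dom (toChart.x le_rfl i) (toChart.θ le_rfl j) = if i = j then 1 else 0

/-- Semidensities on `E`. A semidensity `s√D(x,θ)` is given by its coefficient `s = s(x, θ)` in
every system of Darboux coordinates; under a change of Darboux coordinates the coefficient is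
multiplied by the square root of the Berezinian:
`s' = s · (Ber ∂(x, θ) / ∂(x', θ'))^{1/2}`. -/
def Semidensity {n : ℕ} (E : OddSymplecticSupermanifold.{u, v} n q M) :
    Submodule ℝ (∀ c : DarbouxChart E, E.sec c.dom) where
  carrier := {s | ∀ c c' : DarbouxChart E,
    E.res (inf_le_right : c.dom ⊓ c'.dom ≤ c'.dom) (s c') =
      E.res (inf_le_left : c.dom ⊓ c'.dom ≤ c.dom) (s c) *
        c.sqrtBer c'.toChart inf_le_left inf_le_right}
  add_mem' := by
    intro s t hs ht c c'
    simp only [Pi.add_apply, map_add, hs c c', ht c c', add_mul]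
  zero_mem' := by
    intro c c'
    simp
  smul_mem' := by
    intro r s hs c c'
    simp only [Pi.smul_apply, map_smul, hs c c', smul_mul_assoc]

end OddSymp

end

/-!
The key to the invariance is a comparison of both operators in mixed coordinates. Let `(x, θ)` and
`(x', θ')` be Darboux coordinates on the same open set. Pairing coordinates of the two systems with
the bracket gives `∂x'ᵏ/∂xʲ = {x'ᵏ, θⱼ} = ∂θⱼ/∂θ'ₖ` and three similar relations
(`Frame.DarbouxRel`). Call this even matrix `D`. The relation `{xⁱ, θⱼ} = δ` shows that `D` is
invertible modulo nilpotents, hence invertible, so that `(x', θ)` is a coordinate system as well.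
Write `∇ₖ` and `εⱼ` for its partial derivatives, `G = D⁻¹`, and `g = det G`. Then

* `Δ₀ = ∑ⱼₖ εⱼ Dₖⱼ ∇ₖ` and `Δ₀' = ∑ₖⱼ ∇ₖ Dₖⱼ εⱼ` (`DarbouxRel.lap_eq`, `DarbouxRel.lap'_eq`),
* `G` is the matrix of the `∇ₖ xʲ`, and `εᵢ xʲ` is antisymmetric in `i, j`,
* `Ber ∂(x, θ)/∂(x', θ') = g²` (`DarbouxRel.ber_eq`).

Everything else is the identity `Δ₀' (g s) = g Δ₀ s`, a consequence of the antisymmetry of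
`εᵢ xʲ` and of the formula for the derivative of a determinant (`MixedFrame.sum_dR_eR`). The first
ingredient is the Piola identity `∑ₖ ∇ₖ (g Dₖⱼ) = 0`. The antisymmetry is used twice: in
`∑ⱼ Dₖⱼ εⱼ g = g ∑ⱼ εⱼ Dₖⱼ` and in `∑ₖⱼ ∇ₖ (Dₖⱼ εⱼ g) = 0`. The positive square root of the
Berezinian is `g` multiplied by the sign of its body; the sign is locally constant and commutes with
all derivations.

The charts are given only as isomorphisms of sheaves of algebras, so the chain rule has to be proved
for them. It follows from the fact that a derivation of `C^∞(V) ⊗ Λ` which annihilates the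
coordinates and the odd parameters is zero (`SuperFun.der_eq_zero`); on `C^∞(V)` this is Hadamard's
lemma. The coordinate operators, their commutation relations and the formulas for the bracket in
Darboux coordinates are all derived from this uniqueness (`Frame`).
-/

noncomputable section

namespace OddSymp

/-! ### Derivatives of determinants -/

section Det

variable {S N : Type*} [CommRing S] [Algebra ℝ S] [AddCommGroup N] [Module ℝ N] [Module S N]
  {n : ℕ}

theorem derivation_prod {ι : Type*} [DecidableEq ι] (d : Derivation ℝ S N) (s : Finset ι)
    (f : ι → S) : d (∏ i ∈ s, f i) = ∑ i ∈ s, (∏ j ∈ s.erase i, f j) • d (f i) := by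
  induction s using Finset.induction_on with
  | empty => simp
  | insert a s ha ih =>
    rw [Finset.prod_insert ha, d.leibniz, ih, Finset.sum_insert ha, Finset.erase_insert ha,
      add_comm, Finset.smul_sum]
    congr 1
    refine Finset.sum_congr rfl fun i hi => ?_
    have hai : a ≠ i := fun h => ha (h ▸ hi)
    rw [Finset.erase_insert_of_ne hai,
      Finset.prod_insert (fun h => ha (Finset.mem_of_mem_erase h)), mul_smul]

/-- The derivative of a determinant. -/
theorem derivation_det (d : Derivation ℝ S N) (G : Matrix (Fin n) (Fin n) S) :
    d G.det = ∑ i, ∑ k, G.adjugate i k • d (G k i) := by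
  -- the cofactor of the entry `(k, i)`, as a sum over the permutations with `σ i = k`
  have key : ∀ i k, G.adjugate i k = ∑ σ : Equiv.Perm (Fin n),
      if σ i = k then ((Equiv.Perm.sign σ : ℤˣ) : ℤ) • ∏ j ∈ Finset.univ.erase i, G (σ j) j
      else 0 := by
    intro i k
    rw [← Matrix.transpose_apply G.adjugate k i, Matrix.adjugate_transpose, Matrix.adjugate_apply,
      Matrix.updateRow_transpose, Matrix.det_transpose, Matrix.det_apply]
    refine Finset.sum_congr rfl fun σ _ => ?_
    rw [← Finset.mul_prod_erase Finset.univ _ (Finset.mem_univ i), Matrix.updateCol_self]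
    split_ifs with h
    · rw [h, Pi.single_eq_same, one_mul]
      refine congrArg _ (Finset.prod_congr rfl fun j hj => ?_)
      rw [Matrix.updateCol_ne (Finset.ne_of_mem_erase hj)]
    · rw [Pi.single_eq_of_ne h, zero_mul, smul_zero]
  simp_rw [key, Finset.sum_smul]
  have h2 : ∀ i, ∑ k, ∑ σ : Equiv.Perm (Fin n), (if σ i = k then
      ((Equiv.Perm.sign σ : ℤˣ) : ℤ) • ∏ j ∈ Finset.univ.erase i, G (σ j) j else 0) • d (G k i) =
      ∑ σ : Equiv.Perm (Fin n), ((Equiv.Perm.sign σ : ℤˣ) : ℤ) •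
        (∏ j ∈ Finset.univ.erase i, G (σ j) j) • d (G (σ i) i) := by
    intro i
    rw [Finset.sum_comm]
    refine Finset.sum_congr rfl fun σ _ => ?_
    simp only [ite_smul, zero_smul, Finset.sum_ite_eq, Finset.mem_univ, if_true, smul_assoc]
  simp_rw [h2]
  rw [Finset.sum_comm, Matrix.det_apply, map_sum]
  refine Finset.sum_congr rfl fun σ _ => ?_
  rw [Units.smul_def, map_zsmul, derivation_prod, Finset.smul_sum]

/-- Jacobi's formula for the logarithmic derivative of a determinant. -/
theorem derivation_det_of_mul_eq_one (d : Derivation ℝ S N) {G D : Matrix (Fin n) (Fin n) S}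
    (h : D * G = 1) : d G.det = G.det • ∑ i, ∑ k, D i k • d (G k i) := by
  have hadj : G.adjugate = G.det • D := by
    calc G.adjugate = D * G * G.adjugate := by rw [h, one_mul]
      _ = _ := by rw [mul_assoc, Matrix.mul_adjugate, mul_smul_comm, mul_one]
  rw [derivation_det, hadj]
  simp only [Matrix.smul_apply, Finset.smul_sum, smul_eq_mul, mul_smul]

/-- The derivative of an inverse matrix. -/
theorem derivation_inv_matrix (d : Derivation ℝ S N) {G D : Matrix (Fin n) (Fin n) S}
    (h : D * G = 1) (k j : Fin n) :
    d (D k j) = -∑ p, ∑ q, (D k p * D q j) • d (G p q) := by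
  have h' : G * D = 1 := mul_eq_one_comm.mp h
  -- differentiate `D * G = 1`
  have e : ∀ q, ∑ p, D k p • d (G p q) = -∑ p, G p q • d (D k p) := by
    intro q
    have := congrArg d (congrFun (congrFun h k) q)
    rw [Matrix.mul_apply, map_sum] at this
    simp only [Derivation.leibniz, Finset.sum_add_distrib] at this
    have h1 : d ((1 : Matrix (Fin n) (Fin n) S) k q) = 0 := by
      rw [Matrix.one_apply]; split_ifs <;> simp
    rw [h1] at this
    exact eq_neg_of_add_eq_zero_left this
  rw [Finset.sum_comm]
  have : ∀ q, ∑ p, (D k p * D q j) • d (G p q) = -∑ p, (G p q * D q j) • d (D k p) := by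
    intro q
    have := congrArg (D q j • ·) (e q)
    simp only [Finset.smul_sum, smul_neg, smul_smul] at this
    simpa only [mul_comm] using this
  simp_rw [this]
  rw [Finset.sum_neg_distrib, neg_neg, Finset.sum_comm]
  simp_rw [← Finset.sum_smul, ← Matrix.mul_apply, h', Matrix.one_apply, ite_smul, zero_smul,
    one_smul]
  simp

end Det

/-! ### The identity behind the invariance -/

theorem sum_swap_fst_trd {ι N : Type*} [Fintype ι] [AddCommMonoid N] (f : ι → ι → ι → N) :
    ∑ a, ∑ b, ∑ c, f a b c = ∑ a, ∑ b, ∑ c, f c b a := by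
  rw [Finset.sum_comm]
  conv_rhs => rw [Finset.sum_comm]
  exact Finset.sum_congr rfl fun b _ => Finset.sum_comm

theorem sum_swap_pairs {ι N : Type*} [Fintype ι] [AddCommMonoid N] (f : ι → ι → ι → ι → N) :
    ∑ a, ∑ b, ∑ c, ∑ d, f a b c d = ∑ a, ∑ b, ∑ c, ∑ d, f c d a b := by
  simp_rw [← Fintype.sum_prod_type']
  exact Fintype.sum_equiv (Equiv.prodAssoc ι ι (ι × ι) |>.symm.trans (Equiv.prodComm _ _) |>.trans
    (Equiv.prodAssoc _ _ _)) _ _ fun _ => rfl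

theorem eq_zero_of_eq_neg {N : Type*} [AddCommGroup N] [Module ℝ N] {a : N} (h : a = -a) :
    a = 0 := by
  have h2 : (2 : ℝ) • a = 0 := by
    rw [two_smul]
    nth_rewrite 1 [h]
    exact neg_add_cancel a
  have := congrArg ((2 : ℝ)⁻¹ • ·) h2
  simpa [smul_smul] using this

/-- Commuting even derivations `∂ₖ` and odd derivations `εⱼ` of a superalgebra `R`, acting on a
commutative ring `S` of even elements, together with even elements `xⱼ` such that the matrix
`∂ₖ xⱼ` is invertible and `εᵢ xⱼ` is antisymmetric. For two Darboux coordinate systems these are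
the partial derivatives in the mixed coordinates `(x', θ)`, and the functions `xⱼ(x', θ)`. -/
structure MixedFrame (n : ℕ) (S R : Type*) [CommRing S] [Algebra ℝ S] [Ring R] [Algebra ℝ R]
    [Module S R] where
  /-- The even derivations on the even elements. -/
  d : Fin n → Derivation ℝ S S
  /-- The odd derivations on the even elements. -/
  e : Fin n → Derivation ℝ S R
  /-- The even derivations on the superalgebra. -/
  dR : Fin n → R →ₗ[ℝ] R
  /-- The odd derivations on the superalgebra. -/
  eR : Fin n → R →ₗ[ℝ] R
  dR_smul : ∀ k (a : S) (r : R), dR k (a • r) = d k a • r + a • dR k r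
  eR_smul : ∀ j (a : S) (r : R), eR j (a • r) = e j a * r + a • eR j r
  dR_mul : ∀ k (r s : R), dR k (r * s) = dR k r * s + r * dR k s
  d_comm : ∀ k l (a : S), d k (d l a) = d l (d k a)
  e_d : ∀ j k (a : S), e j (d k a) = dR k (e j a)
  eR_dR : ∀ j k (r : R), eR j (dR k r) = dR k (eR j r)
  /-- The even functions. -/
  x : Fin n → S
  /-- The inverse of the matrix `∂ₖ xⱼ`. -/
  D : Matrix (Fin n) (Fin n) S
  D_mul : D * Matrix.of (fun j k => d k (x j)) = 1
  anti : ∀ i j, e i (x j) = -e j (x i)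

namespace MixedFrame

variable {n : ℕ} {S R : Type*} [CommRing S] [Algebra ℝ S] [Ring R] [Algebra ℝ R] [Module S R]
  (F : MixedFrame n S R)

/-- The matrix `∂ₖ xⱼ`. -/
def G : Matrix (Fin n) (Fin n) S := Matrix.of fun j k => F.d k (F.x j)

theorem derivation_det {N : Type*} [AddCommGroup N] [Module ℝ N] [Module S N]
    (δ : Derivation ℝ S N) :
    δ F.G.det = F.G.det • ∑ p, ∑ q, F.D q p • δ (F.d q (F.x p)) := by
  have h := derivation_det_of_mul_eq_one δ F.D_mul
  rw [Finset.sum_comm] at h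
  exact h

theorem derivation_D {N : Type*} [AddCommGroup N] [Module ℝ N] [Module S N]
    (δ : Derivation ℝ S N) (k j : Fin n) :
    δ (F.D k j) = -∑ p, ∑ q, (F.D k p * F.D q j) • δ (F.d q (F.x p)) :=
  derivation_inv_matrix δ F.D_mul k j

/-- The Piola identity: the rows of the cofactor matrix of a Jacobian matrix have divergence zero.
It holds because the second derivatives `∂ₖ ∂ₗ xⱼ` are symmetric. -/
theorem piola (j : Fin n) : ∑ k, F.d k (F.G.det * F.D k j) = 0 := by
  simp_rw [Derivation.leibniz, F.derivation_det, F.derivation_D, Finset.sum_add_distrib]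
  simp only [smul_eq_mul, mul_neg, Finset.sum_neg_distrib]
  rw [neg_add_eq_zero]
  simp only [Finset.mul_sum]
  rw [sum_swap_fst_trd]
  refine Finset.sum_congr rfl fun k _ => Finset.sum_congr rfl fun p _ =>
    Finset.sum_congr rfl fun q _ => ?_
  rw [F.d_comm]
  ring

theorem e_d_x_antisymm (j p q : Fin n) : F.e j (F.d q (F.x p)) = -F.e p (F.d q (F.x j)) := by
  rw [F.e_d, F.e_d, F.anti, map_neg]

/-- The first consequence of the antisymmetry of `εᵢ xⱼ`. -/
theorem sum_e_det_eq (k : Fin n) :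
    ∑ j, F.D k j • F.e j F.G.det = F.G.det • ∑ j, F.e j (F.D k j) := by
  simp_rw [F.derivation_det, F.derivation_D, Finset.smul_sum, smul_neg, Finset.smul_sum]
  rw [Finset.sum_comm]
  refine Finset.sum_congr rfl fun p _ => ?_
  rw [← Finset.sum_neg_distrib]
  refine Finset.sum_congr rfl fun j _ => ?_
  rw [← Finset.sum_neg_distrib]
  refine Finset.sum_congr rfl fun q _ => ?_
  rw [F.e_d_x_antisymm]
  module

/-- The logarithmic derivative of `det (∂ₖ xⱼ)` in the direction `εⱼ`. -/
def v (j : Fin n) : R := ∑ p, ∑ q, F.D q p • F.e j (F.d q (F.x p))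

/-- The antisymmetry of `εᵢ xⱼ` against the symmetry of the second derivatives along `∂`: expanding
the logarithmic derivatives `v` gives two sums, each of which changes sign under exchange of the
two pairs of indices. -/
theorem sum_D_smul_dR_v : ∑ k, ∑ j, F.D k j • F.dR k (F.v j) = 0 := by
  have key : ∀ f : Fin n → Fin n → Fin n → Fin n → R, (∀ k j q p, f k j q p = -f q p k j) →
      ∑ k, ∑ j, ∑ q, ∑ p, f k j q p = 0 := by
    intro f hf
    refine eq_zero_of_eq_neg ?_
    conv_lhs => rw [sum_swap_pairs]
    simp_rw [← Finset.sum_neg_distrib]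
    exact Finset.sum_congr rfl fun k _ => Finset.sum_congr rfl fun j _ =>
      Finset.sum_congr rfl fun q _ => Finset.sum_congr rfl fun p _ => hf _ _ _ _
  -- the terms in which `∂` falls on the derivatives of `xⱼ`
  have h1 : ∑ k, ∑ j, ∑ q, ∑ p, (F.D k j * F.D q p) • F.e j (F.d k (F.d q (F.x p))) = 0 := by
    refine key _ fun k j q p => ?_
    rw [F.e_d, F.e_d_x_antisymm, map_neg, ← F.e_d, F.d_comm]
    module
  -- the terms in which `∂` falls on the matrix `D`
  have h2 : ∑ k, ∑ j, ∑ b, ∑ p, ∑ q, ∑ a,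
      (F.D k j * (F.D q a * F.D b p) * F.d k (F.d b (F.x a))) • F.e j (F.d q (F.x p)) = 0 := by
    refine key _ fun k j b p => ?_
    rw [← Finset.sum_neg_distrib]
    refine Finset.sum_congr rfl fun q _ => ?_
    rw [← Finset.sum_neg_distrib]
    refine Finset.sum_congr rfl fun a _ => ?_
    rw [F.e_d_x_antisymm, F.d_comm]
    module
  have h3 : ∀ k j, F.D k j • F.dR k (F.v j) =
      ∑ q, ∑ p, (F.D k j * F.D q p) • F.e j (F.d k (F.d q (F.x p))) -
      ∑ b, ∑ p, ∑ q, ∑ a,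
        (F.D k j * (F.D q a * F.D b p) * F.d k (F.d b (F.x a))) • F.e j (F.d q (F.x p)) := by
    intro k j
    have h4 : ∀ p q, F.D k j • F.dR k (F.D q p • F.e j (F.d q (F.x p))) =
        (F.D k j * F.D q p) • F.e j (F.d k (F.d q (F.x p))) - ∑ b, ∑ a,
        (F.D k j * (F.D q a * F.D b p) * F.d k (F.d b (F.x a))) • F.e j (F.d q (F.x p)) := by
      intro p q
      rw [F.dR_smul, F.derivation_D, ← F.e_d, smul_add, smul_smul, smul_smul, add_comm,
        sub_eq_add_neg, Finset.sum_comm]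
      simp only [mul_neg, neg_smul, Finset.mul_sum, Finset.sum_smul, smul_eq_mul, mul_assoc]
    simp only [v, map_sum, Finset.smul_sum, h4, Finset.sum_sub_distrib]
    refine congrArg₂ _ ?_ ?_
    · exact Finset.sum_comm
    · conv_rhs => rw [Finset.sum_comm]
      exact Finset.sum_congr rfl fun p _ => Finset.sum_comm
  simp_rw [h3, Finset.sum_sub_distrib, h1, h2, sub_zero]

/-- The second consequence of the antisymmetry of `εᵢ xⱼ`: the operator `∑ ∂ₖ Dₖⱼ εⱼ` annihilates
`det (∂ₖ xⱼ)`. -/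
theorem sum_dR_eq_zero : ∑ k, F.dR k (∑ j, F.D k j • F.e j F.G.det) = 0 := by
  have h : ∀ k, F.dR k (∑ j, F.D k j • F.e j F.G.det) =
      ∑ j, (F.d k (F.G.det * F.D k j) • F.v j + F.G.det • F.D k j • F.dR k (F.v j)) := by
    intro k
    rw [map_sum]
    refine Finset.sum_congr rfl fun j _ => ?_
    rw [F.derivation_det, smul_smul, F.dR_smul, mul_comm, smul_smul]
    rfl
  simp_rw [h, Finset.sum_add_distrib, ← Finset.smul_sum]
  rw [F.sum_D_smul_dR_v, smul_zero, add_zero, Finset.sum_comm]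
  simp_rw [← Finset.sum_smul, F.piola, zero_smul, Finset.sum_const_zero]

/-- Multiplication by `det (∂ₖ xⱼ)` intertwines the operators `∑ εⱼ Dₖⱼ ∂ₖ` and `∑ ∂ₖ Dₖⱼ εⱼ`, which
are the coordinate odd Laplacians of the two Darboux coordinate systems. -/
theorem sum_dR_eR [IsScalarTower S R R] (s : R) :
    ∑ k, F.dR k (∑ j, F.D k j • F.eR j (F.G.det • s)) =
      F.G.det • ∑ j, F.eR j (∑ k, F.D k j • F.dR k s) := by
  have h1 : ∀ k, F.dR k (∑ j, F.D k j • F.eR j (F.G.det • s)) =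
      F.dR k (∑ j, F.D k j • F.e j F.G.det) * s + (∑ j, F.D k j • F.e j F.G.det) * F.dR k s +
      ∑ j, F.d k (F.G.det * F.D k j) • F.eR j s + ∑ j, (F.G.det * F.D k j) • F.dR k (F.eR j s) := by
    intro k
    rw [← F.dR_mul, add_assoc, ← Finset.sum_add_distrib]
    simp_rw [← F.dR_smul]
    rw [← map_sum, ← map_add, Finset.sum_mul, ← Finset.sum_add_distrib]
    refine congrArg _ (Finset.sum_congr rfl fun j _ => ?_)
    rw [F.eR_smul, smul_add, smul_mul_assoc, smul_smul, mul_comm]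
  simp_rw [h1, Finset.sum_add_distrib, ← Finset.sum_mul, F.sum_dR_eq_zero, F.sum_e_det_eq]
  rw [zero_mul, zero_add, Finset.sum_comm (f := fun k j => F.d k (F.G.det * F.D k j) • F.eR j s)]
  simp_rw [← Finset.sum_smul, F.piola, zero_smul, Finset.sum_const_zero, add_zero, map_sum,
    F.eR_smul, Finset.sum_add_distrib, smul_add, Finset.smul_sum, Finset.sum_mul, F.eR_dR,
    smul_mul_assoc, smul_smul]
  rw [Finset.sum_comm]
  congr 1
  rw [Finset.sum_comm]

end MixedFrame

/-! ### Supercommutative algebras and their derivations -/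

section SuperAlgebra

variable {R : Type*} [Ring R] [Algebra ℝ R] {α : R →ₐ[ℝ] R}

/-- `R` is supercommutative with respect to the parity involution `α`. -/
structure IsSuperComm (α : R →ₐ[ℝ] R) : Prop where
  invol : ∀ f, α (α f) = f
  even_comm : ∀ a f, α a = a → a * f = f * a
  odd_anticomm : ∀ a b, α a = -a → α b = -b → a * b = -(b * a)

namespace IsSuperComm

theorem exists_even_odd (hS : IsSuperComm α) (f : R) :
    ∃ a b, α a = a ∧ α b = -b ∧ f = a + b := by
  refine ⟨(2 : ℝ)⁻¹ • (f + α f), (2 : ℝ)⁻¹ • (f - α f), ?_, ?_, ?_⟩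
  · rw [map_smul, map_add, hS.invol, add_comm]
  · rw [map_smul, map_sub, hS.invol, ← smul_neg, neg_sub]
  · module

/-- Moving an odd element to the right past an arbitrary element applies the parity involution. -/
theorem odd_mul (hS : IsSuperComm α) {b : R} (hb : α b = -b) (f : R) : b * f = α f * b := by
  obtain ⟨a, c, ha, hc, rfl⟩ := hS.exists_even_odd f
  rw [map_add, ha, hc, mul_add, add_mul, ← hS.even_comm a b ha, hS.odd_anticomm b c hb hc, neg_mul]

theorem odd_sq (hS : IsSuperComm α) {b : R} (hb : α b = -b) : b * b = 0 :=
  eq_zero_of_eq_neg (hS.odd_anticomm b b hb hb)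

/-- The subalgebra of even elements. It depends on the proof of supercommutativity, which makes it a
commutative ring. -/
def even (_ : IsSuperComm α) : Subalgebra ℝ R := AlgHom.equalizer α (AlgHom.id ℝ R)

variable (hS : IsSuperComm α)

theorem mem_even {a : R} : a ∈ hS.even ↔ α a = a := Iff.rfl

instance : CommRing hS.even :=
  { (inferInstance : Ring hS.even) with
    mul_comm := fun a b => Subtype.ext (hS.even_comm a b a.2) }

theorem coe_comm (a : hS.even) (f : R) : (a : R) * f = f * a := hS.even_comm a f a.2

/-- The product of two odd elements is nilpotent, as an element of the ring of even elements. -/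
theorem isNilpotent_of_odd_mul_odd {a : hS.even} {b c : R} (hb : α b = -b) (hc : α c = -c)
    (h : (a : R) = b * c) : IsNilpotent a := by
  refine ⟨2, Subtype.ext ?_⟩
  have : b * c * (b * c) = 0 := by
    rw [mul_assoc, ← mul_assoc c, hS.odd_anticomm c b hc hb, neg_mul, mul_neg, ← mul_assoc,
      ← mul_assoc, hS.odd_sq hb, zero_mul, zero_mul, neg_zero]
  rw [pow_two]
  simpa [h] using this

end IsSuperComm

/-- Even derivations of a superalgebra: they preserve the parity and satisfy the Leibniz rule. -/
structure IsEvenDer (α : R →ₐ[ℝ] R) (X : R →ₗ[ℝ] R) : Prop where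
  map_mul : ∀ f g, X (f * g) = X f * g + f * X g
  map_par : ∀ f, α (X f) = X (α f)

/-- Odd (left) derivations of a superalgebra: they change the parity, and satisfy the Leibniz rule
with a sign. -/
structure IsOddDer (α : R →ₐ[ℝ] R) (X : R →ₗ[ℝ] R) : Prop where
  map_mul : ∀ f g, X (f * g) = X f * g + α f * X g
  map_par : ∀ f, α (X f) = -X (α f)

namespace IsEvenDer

variable {X Y : R →ₗ[ℝ] R}

theorem map_one (hX : IsEvenDer α X) : X 1 = 0 := by
  have := hX.map_mul 1 1
  simpa using this

theorem map_ite (hX : IsEvenDer α X) (p : Prop) [Decidable p] : X (if p then 1 else 0) = 0 := by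
  split_ifs
  · exact hX.map_one
  · exact map_zero X

theorem zero : IsEvenDer α (0 : R →ₗ[ℝ] R) := ⟨by simp, by simp⟩

theorem add (hX : IsEvenDer α X) (hY : IsEvenDer α Y) : IsEvenDer α (X + Y) where
  map_mul f g := by
    simp only [LinearMap.add_apply, hX.map_mul, hY.map_mul, add_mul, mul_add]; abel
  map_par f := by simp only [LinearMap.add_apply, map_add, hX.map_par, hY.map_par]

theorem neg (hX : IsEvenDer α X) : IsEvenDer α (-X) where
  map_mul f g := by
    simp only [LinearMap.neg_apply, hX.map_mul, neg_mul, mul_neg]; abel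
  map_par f := by simp only [LinearMap.neg_apply, map_neg, hX.map_par]

theorem sub (hX : IsEvenDer α X) (hY : IsEvenDer α Y) : IsEvenDer α (X - Y) :=
  sub_eq_add_neg X Y ▸ hX.add hY.neg

theorem sum {ι : Type*} {s : Finset ι} {X : ι → R →ₗ[ℝ] R} (h : ∀ i, IsEvenDer α (X i)) :
    IsEvenDer α (∑ i ∈ s, X i) :=
  Finset.sum_induction _ _ (fun _ _ => add) zero fun i _ => h i

end IsEvenDer

namespace IsOddDer

variable {X Y : R →ₗ[ℝ] R}

theorem map_one (hX : IsOddDer α X) : X 1 = 0 := by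
  have := hX.map_mul 1 1
  simpa using this

theorem map_ite (hX : IsOddDer α X) (p : Prop) [Decidable p] : X (if p then 1 else 0) = 0 := by
  split_ifs
  · exact hX.map_one
  · exact map_zero X

theorem zero : IsOddDer α (0 : R →ₗ[ℝ] R) := ⟨by simp, by simp⟩

theorem add (hX : IsOddDer α X) (hY : IsOddDer α Y) : IsOddDer α (X + Y) where
  map_mul f g := by
    simp only [LinearMap.add_apply, hX.map_mul, hY.map_mul, add_mul, mul_add]; abel
  map_par f := by simp only [LinearMap.add_apply, map_add, hX.map_par, hY.map_par]; abel

theorem neg (hX : IsOddDer α X) : IsOddDer α (-X) where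
  map_mul f g := by
    simp only [LinearMap.neg_apply, hX.map_mul, neg_mul, mul_neg]; abel
  map_par f := by simp only [LinearMap.neg_apply, map_neg, hX.map_par]

theorem sub (hX : IsOddDer α X) (hY : IsOddDer α Y) : IsOddDer α (X - Y) :=
  sub_eq_add_neg X Y ▸ hX.add hY.neg

theorem sum {ι : Type*} {s : Finset ι} {X : ι → R →ₗ[ℝ] R} (h : ∀ i, IsOddDer α (X i)) :
    IsOddDer α (∑ i ∈ s, X i) :=
  Finset.sum_induction _ _ (fun _ _ => add) zero fun i _ => h i

end IsOddDer

variable {X Y : R →ₗ[ℝ] R}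

theorem IsEvenDer.commutator (hX : IsEvenDer α X) (hY : IsEvenDer α Y) :
    IsEvenDer α (X ∘ₗ Y - Y ∘ₗ X) where
  map_mul f g := by
    simp only [LinearMap.sub_apply, LinearMap.comp_apply, hX.map_mul, hY.map_mul, map_add, sub_mul,
      mul_sub]
    abel
  map_par f := by
    simp only [LinearMap.sub_apply, LinearMap.comp_apply, map_sub, hX.map_par, hY.map_par]

theorem IsOddDer.commutator (hX : IsOddDer α X) (hY : IsEvenDer α Y) :
    IsOddDer α (X ∘ₗ Y - Y ∘ₗ X) where
  map_mul f g := by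
    simp only [LinearMap.sub_apply, LinearMap.comp_apply, hX.map_mul, hY.map_mul, map_add, sub_mul,
      mul_sub, hY.map_par]
    abel
  map_par f := by
    simp only [LinearMap.sub_apply, LinearMap.comp_apply, map_sub, hX.map_par, hY.map_par, map_neg]
    abel

theorem IsOddDer.anticommutator (hS : IsSuperComm α) (hX : IsOddDer α X) (hY : IsOddDer α Y) :
    IsEvenDer α (X ∘ₗ Y + Y ∘ₗ X) where
  map_mul f g := by
    simp only [LinearMap.add_apply, LinearMap.comp_apply, hX.map_mul, hY.map_mul, map_add, add_mul,
      mul_add, hX.map_par, hY.map_par, hS.invol, neg_mul]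
    abel
  map_par f := by
    simp only [LinearMap.add_apply, LinearMap.comp_apply, map_add, hX.map_par, hY.map_par, map_neg,
      neg_neg]

/-- Left multiplication of an operator by a function. -/
def mulOp (a : R) (X : R →ₗ[ℝ] R) : R →ₗ[ℝ] R := LinearMap.mulLeft ℝ a ∘ₗ X

@[simp] theorem mulOp_apply (a : R) (X : R →ₗ[ℝ] R) (f : R) : mulOp a X f = a * X f := rfl

theorem IsEvenDer.even_mul (hX : IsEvenDer α X) (hS : IsSuperComm α) {a : R} (ha : α a = a) :
    IsEvenDer α (mulOp a X) where
  map_mul f g := by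
    simp only [mulOp_apply, hX.map_mul, mul_add, mul_assoc]
    rw [← mul_assoc a f, hS.even_comm a f ha, mul_assoc]
  map_par f := by simp only [mulOp_apply, _root_.map_mul, ha, hX.map_par]

theorem IsOddDer.even_mul (hX : IsOddDer α X) (hS : IsSuperComm α) {a : R} (ha : α a = a) :
    IsOddDer α (mulOp a X) where
  map_mul f g := by
    simp only [mulOp_apply, hX.map_mul, mul_add, mul_assoc]
    rw [← mul_assoc a (α f), hS.even_comm a (α f) ha, mul_assoc]
  map_par f := by simp only [mulOp_apply, _root_.map_mul, ha, hX.map_par, mul_neg]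

theorem IsEvenDer.odd_mul (hX : IsEvenDer α X) (hS : IsSuperComm α) {a : R} (ha : α a = -a) :
    IsOddDer α (mulOp a X) where
  map_mul f g := by
    simp only [mulOp_apply, hX.map_mul, mul_add, mul_assoc]
    rw [← mul_assoc a f, hS.odd_mul ha f, mul_assoc]
  map_par f := by simp only [mulOp_apply, _root_.map_mul, ha, hX.map_par, neg_mul]

theorem IsOddDer.odd_mul (hX : IsOddDer α X) (hS : IsSuperComm α) {a : R} (ha : α a = -a) :
    IsEvenDer α (mulOp a X) where
  map_mul f g := by
    simp only [mulOp_apply, hX.map_mul, mul_add, mul_assoc]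
    rw [← mul_assoc a (α f), hS.odd_mul ha (α f), hS.invol, mul_assoc]
  map_par f := by simp only [mulOp_apply, _root_.map_mul, ha, hX.map_par, neg_mul_neg]

/-- An even derivation, restricted to the even elements. -/
def IsEvenDer.toDerivation (hX : IsEvenDer α X) (hS : IsSuperComm α) :
    Derivation ℝ hS.even hS.even :=
  Derivation.mk' (X.restrict (p := hS.even.toSubmodule) (q := hS.even.toSubmodule) fun a ha => by
    rw [Subalgebra.mem_toSubmodule, hS.mem_even] at *
    rw [hX.map_par, ha]) fun a b => Subtype.ext <| by
    have := hX.map_mul a b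
    rw [← hS.coe_comm b (X a), add_comm] at this
    exact this

/-- An odd derivation, restricted to the even elements. -/
def IsOddDer.toDerivation (hX : IsOddDer α X) (hS : IsSuperComm α) :
    Derivation ℝ hS.even R :=
  Derivation.mk' (X ∘ₗ hS.even.toSubmodule.subtype) fun a b => by
    have h := hX.map_mul a b
    rw [← hS.coe_comm b (X a), add_comm, hS.mem_even.mp a.2] at h
    exact h

/-- On matrices with even entries, the Leibniz formula gives the determinant over the commutative ring
of even elements. -/
theorem ldet_coe (hS : IsSuperComm α) {n : ℕ} (A : Matrix (Fin n) (Fin n) hS.even) :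
    ldet (A.map ((↑) : hS.even → R)) = (A.det : R) := by
  change _ = hS.even.val A.det
  rw [Matrix.det_apply, map_sum, ldet]
  refine Finset.sum_congr rfl fun σ _ => ?_
  rw [Units.smul_def, map_zsmul, ← List.prod_ofFn, map_list_prod, List.map_ofFn]
  rfl

theorem IsSuperComm.map_coe_mul (hS : IsSuperComm α) {n : ℕ}
    (A B : Matrix (Fin n) (Fin n) hS.even) :
    A.map ((↑) : hS.even → R) * B.map (↑) = (A * B).map (↑) :=
  (Matrix.map_mul (f := hS.even.val.toRingHom)).symm

theorem IsSuperComm.map_coe_one (hS : IsSuperComm α) {n : ℕ} :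
    (1 : Matrix (Fin n) (Fin n) hS.even).map ((↑) : hS.even → R) = 1 :=
  Matrix.map_one _ rfl rfl

end SuperAlgebra

/-! ### Coordinate frames and changes of Darboux coordinates -/

/-- A coordinate frame of a superalgebra with odd parameters `η`: even and odd coordinates together
with their partial derivatives, such that derivations over the parameters are determined by their
values on the coordinates. -/
structure Frame (n : ℕ) {q : ℕ} {R : Type*} [Ring R] [Algebra ℝ R] (α : R →ₐ[ℝ] R)
    (η : Fin q → R) where
  /-- The even coordinates. -/
  x : Fin n → R
  /-- The odd coordinates. -/
  θ : Fin n → R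
  /-- The derivatives along the even coordinates. -/
  dx : Fin n → R →ₗ[ℝ] R
  /-- The derivatives along the odd coordinates. -/
  dθ : Fin n → R →ₗ[ℝ] R
  par_x : ∀ i, α (x i) = x i
  par_θ : ∀ i, α (θ i) = -θ i
  dx_der : ∀ i, IsEvenDer α (dx i)
  dθ_der : ∀ i, IsOddDer α (dθ i)
  dx_x : ∀ i j, dx i (x j) = if i = j then 1 else 0
  dx_θ : ∀ i j, dx i (θ j) = 0
  dx_η : ∀ i a, dx i (η a) = 0
  dθ_x : ∀ i j, dθ i (x j) = 0
  dθ_θ : ∀ i j, dθ i (θ j) = if i = j then 1 else 0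
  dθ_η : ∀ i a, dθ i (η a) = 0
  even_ext : ∀ X, IsEvenDer α X → (∀ i, X (x i) = 0) → (∀ i, X (θ i) = 0) → (∀ a, X (η a) = 0) →
    X = 0
  odd_ext : ∀ X, IsOddDer α X → (∀ i, X (x i) = 0) → (∀ i, X (θ i) = 0) → (∀ a, X (η a) = 0) →
    X = 0

namespace Frame

variable {n q : ℕ} {R : Type*} [Ring R] [Algebra ℝ R] {α : R →ₐ[ℝ] R} {η : Fin q → R}
  (F : Frame n α η)

/-- The coordinate odd Laplacian. -/
def lap : R →ₗ[ℝ] R := ∑ i, F.dx i ∘ₗ F.dθ i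

/-- The chain rule for even derivations. -/
theorem even_chain (hS : IsSuperComm α) {X : R →ₗ[ℝ] R} (hX : IsEvenDer α X)
    (hη : ∀ a, X (η a) = 0) (f : R) :
    X f = ∑ i, X (F.x i) * F.dx i f + ∑ i, X (F.θ i) * F.dθ i f := by
  have h := F.even_ext (X - (∑ i, mulOp (X (F.x i)) (F.dx i) + ∑ i, mulOp (X (F.θ i)) (F.dθ i)))
    (hX.sub (.add (.sum fun i => (F.dx_der i).even_mul hS (by rw [hX.map_par, F.par_x]))
      (.sum fun i => (F.dθ_der i).odd_mul hS (by rw [hX.map_par, F.par_θ, map_neg]))))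
    (fun j => by simp [F.dx_x, F.dθ_x]) (fun j => by simp [F.dx_θ, F.dθ_θ])
    (fun a => by simp [F.dx_η, F.dθ_η, hη])
  simpa [sub_eq_zero] using LinearMap.congr_fun h f

/-- The chain rule for odd derivations. -/
theorem odd_chain (hS : IsSuperComm α) {X : R →ₗ[ℝ] R} (hX : IsOddDer α X)
    (hη : ∀ a, X (η a) = 0) (f : R) :
    X f = ∑ i, X (F.x i) * F.dx i f + ∑ i, X (F.θ i) * F.dθ i f := by
  have h := F.odd_ext (X - (∑ i, mulOp (X (F.x i)) (F.dx i) + ∑ i, mulOp (X (F.θ i)) (F.dθ i)))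
    (hX.sub (.add (.sum fun i => (F.dx_der i).odd_mul hS (by rw [hX.map_par, F.par_x]))
      (.sum fun i => (F.dθ_der i).even_mul hS (by rw [hX.map_par, F.par_θ, map_neg, neg_neg]))))
    (fun j => by simp [F.dx_x, F.dθ_x]) (fun j => by simp [F.dx_θ, F.dθ_θ])
    (fun a => by simp [F.dx_η, F.dθ_η, hη])
  simpa [sub_eq_zero] using LinearMap.congr_fun h f

theorem dx_comm (i j : Fin n) (f : R) : F.dx i (F.dx j f) = F.dx j (F.dx i f) := by
  have h := F.even_ext _ ((F.dx_der i).commutator (F.dx_der j))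
    (fun k => by simp [F.dx_x, (F.dx_der _).map_ite]) (fun k => by simp [F.dx_θ])
    (fun a => by simp [F.dx_η])
  simpa [sub_eq_zero] using LinearMap.congr_fun h f

theorem dθ_dx_comm (i j : Fin n) (f : R) : F.dθ i (F.dx j f) = F.dx j (F.dθ i f) := by
  have h := F.odd_ext _ ((F.dθ_der i).commutator (F.dx_der j))
    (fun k => by simp [F.dx_x, F.dθ_x, (F.dθ_der _).map_ite])
    (fun k => by simp [F.dx_θ, F.dθ_θ, (F.dx_der _).map_ite])
    (fun a => by simp [F.dx_η, F.dθ_η])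
  simpa [sub_eq_zero] using LinearMap.congr_fun h f

theorem dθ_anticomm (hS : IsSuperComm α) (i j : Fin n) (f : R) :
    F.dθ i (F.dθ j f) = -F.dθ j (F.dθ i f) := by
  have h := F.even_ext _ ((F.dθ_der i).anticommutator hS (F.dθ_der j))
    (fun k => by simp [F.dθ_x])
    (fun k => by simp [F.dθ_θ, (F.dθ_der _).map_ite])
    (fun a => by simp [F.dθ_η])
  simpa [add_eq_zero_iff_eq_neg] using LinearMap.congr_fun h f

theorem lap_apply (f : R) : F.lap f = ∑ i, F.dx i (F.dθ i f) := by simp [lap]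

theorem sum_eq_zero_of_antisymm {f : Fin n → Fin n → R} (h : ∀ i j, f i j = -f j i) :
    ∑ i, ∑ j, f i j = 0 := by
  refine eq_zero_of_eq_neg ?_
  conv_lhs => rw [Finset.sum_comm]
  simp_rw [← Finset.sum_neg_distrib]
  exact Finset.sum_congr rfl fun i _ => Finset.sum_congr rfl fun j _ => h j i

/-- The derivatives `∂/∂xⁱ` commute and the `∂/∂θᵢ` anticommute, so that the terms of `Δ₀²` cancel
in pairs. -/
theorem lap_lap (hS : IsSuperComm α) (f : R) : F.lap (F.lap f) = 0 := by
  simp_rw [lap_apply, map_sum]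
  refine sum_eq_zero_of_antisymm fun i j => ?_
  rw [F.dθ_dx_comm, F.dθ_anticomm hS, map_neg, map_neg, F.dx_comm, F.dθ_dx_comm]

/-- Two coordinate frames are Darboux related if the coordinates satisfy the relations which hold
for two systems of Darboux coordinates of the same odd Poisson bracket: each relation expresses the
bracket of a coordinate of one system with a coordinate of the other in both systems. -/
structure DarbouxRel (F F' : Frame n α η) : Prop where
  dx_x : ∀ j k, F.dx j (F'.x k) = F'.dθ k (F.θ j)
  dθ_x : ∀ i k, F.dθ i (F'.x k) = F'.dθ k (F.x i)
  dθ_θ : ∀ i k, F.dθ i (F'.θ k) = F'.dx k (F.x i)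
  dx_θ : ∀ i k, F.dx i (F'.θ k) = -F'.dx k (F.θ i)

namespace DarbouxRel

variable {F} {F' : Frame n α η} (h : DarbouxRel F F') (hS : IsSuperComm α)

/-- The matrix `∂x'ᵏ/∂xʲ = ∂θⱼ/∂θ'ₖ`. -/
def D (_ : DarbouxRel F F') (hS : IsSuperComm α) : Matrix (Fin n) (Fin n) hS.even :=
  Matrix.of fun k j => ⟨F.dx j (F'.x k), by rw [hS.mem_even, (F.dx_der j).map_par, F'.par_x]⟩

theorem coe_D (k j : Fin n) : (h.D hS k j : R) = F.dx j (F'.x k) := rfl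

theorem coe_D' (k j : Fin n) : (h.D hS k j : R) = F'.dθ k (F.θ j) := h.dx_x j k

/-- With `A = ∂x/∂x'`, the relation `{xⁱ, θⱼ} = δ` says that `Aᵀ D` differs from the identity by a
matrix whose entries are sums of products of odd elements, hence nilpotent. -/
theorem isUnit_D : IsUnit (h.D hS) := by
  let A : Matrix (Fin n) (Fin n) hS.even :=
    Matrix.of fun k i => ⟨F'.dx k (F.x i), by rw [hS.mem_even, (F'.dx_der k).map_par, F.par_x]⟩
  have hC : ∀ k i, α (F'.dθ k (F.x i)) = -F'.dθ k (F.x i) := fun k i => by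
    rw [(F'.dθ_der k).map_par, F.par_x]
  have hB : ∀ k i, α (F'.dx k (F.θ i)) = -F'.dx k (F.θ i) := fun k i => by
    rw [(F'.dx_der k).map_par, F.par_θ, map_neg]
  let N : Fin n → Fin n → Fin n → hS.even := fun i j k =>
    ⟨F'.dθ k (F.x i) * F'.dx k (F.θ j), by rw [hS.mem_even, map_mul, hC, hB, neg_mul_neg]⟩
  have e : A.transpose * h.D hS + Matrix.of (fun i j => ∑ k, N i j k) = 1 := by
    ext i j
    have h1 := F'.odd_chain hS (F.dθ_der i) (F.dθ_η i) (F.θ j)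
    simp only [F.dθ_θ, h.dθ_x, h.dθ_θ, ← h.dx_x] at h1
    rw [Matrix.add_apply, Matrix.mul_apply]
    simp only [Matrix.one_apply, Matrix.transpose_apply, Matrix.of_apply]
    push_cast
    rw [apply_ite (fun a : hS.even => (a : R))]
    rw [add_comm]
    exact h1.symm
  let φ := Ideal.Quotient.mk (nilradical hS.even)
  have hN : ∀ i j k, φ (N i j k) = 0 := fun i j k => Ideal.Quotient.eq_zero_iff_mem.mpr
    (mem_nilradical.mpr (hS.isNilpotent_of_odd_mul_odd (hC k i) (hB k j) rfl))
  have e2 : φ (A.transpose.det * (h.D hS).det) = 1 := by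
    rw [← Matrix.det_mul, eq_sub_of_add_eq e, RingHom.map_det]
    have : φ.mapMatrix (1 - Matrix.of fun i j => ∑ k, N i j k) = 1 := by
      rw [map_sub, map_one, sub_eq_self]
      ext i j
      simp [hN]
    rw [this, Matrix.det_one]
  rw [Matrix.isUnit_iff_isUnit_det]
  have e3 : IsNilpotent (A.transpose.det * (h.D hS).det - 1) := by
    rw [← mem_nilradical, ← Ideal.Quotient.eq_zero_iff_mem, map_sub, map_one, sub_eq_zero]
    exact e2
  have e4 := e3.isUnit_add_one
  rw [sub_add_cancel] at e4
  exact isUnit_of_mul_isUnit_right e4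

/-- The matrix inverse to `∂x'ᵏ/∂xʲ`. -/
def G : Matrix (Fin n) (Fin n) hS.even := Ring.inverse (h.D hS)

theorem D_mul_G : h.D hS * h.G hS = 1 := Ring.mul_inverse_cancel _ (h.isUnit_D hS)

theorem G_mul_D : h.G hS * h.D hS = 1 := Ring.inverse_mul_cancel _ (h.isUnit_D hS)

theorem sum_D_mul_G (k j : Fin n) :
    ∑ i, (h.D hS k i : R) * h.G hS i j = if k = j then 1 else 0 := by
  have := congrArg (fun a : hS.even => (a : R)) (congrFun (congrFun (h.D_mul_G hS) k) j)
  rw [Matrix.mul_apply, Matrix.one_apply, apply_ite (fun a : hS.even => (a : R))] at this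
  simpa using this

theorem sum_G_mul_D (k j : Fin n) :
    ∑ i, (h.G hS k i : R) * h.D hS i j = if k = j then 1 else 0 := by
  have := congrArg (fun a : hS.even => (a : R)) (congrFun (congrFun (h.G_mul_D hS) k) j)
  rw [Matrix.mul_apply, Matrix.one_apply, apply_ite (fun a : hS.even => (a : R))] at this
  simpa using this

/-- The derivative `∂/∂x'ᵏ` in the mixed coordinates `(x', θ)`. -/
def nab (k : Fin n) : R →ₗ[ℝ] R := ∑ j, mulOp (h.G hS j k) (F.dx j)

/-- The derivative `∂/∂θⱼ` in the mixed coordinates `(x', θ)`. -/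
def eps (j : Fin n) : R →ₗ[ℝ] R := ∑ k, mulOp (h.G hS j k) (F'.dθ k)

theorem nab_der (k : Fin n) : IsEvenDer α (h.nab hS k) :=
  .sum fun j => (F.dx_der j).even_mul hS (h.G hS j k).2

theorem eps_der (j : Fin n) : IsOddDer α (h.eps hS j) :=
  .sum fun k => (F'.dθ_der k).even_mul hS (h.G hS j k).2

theorem nab_apply (k : Fin n) (f : R) : h.nab hS k f = ∑ j, (h.G hS j k : R) * F.dx j f := by
  simp [nab]

theorem eps_apply (j : Fin n) (f : R) : h.eps hS j f = ∑ k, (h.G hS j k : R) * F'.dθ k f := by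
  simp [eps]

theorem nab_η (k : Fin n) (a : Fin q) : h.nab hS k (η a) = 0 := by simp [nab_apply, F.dx_η]
theorem eps_η (j : Fin n) (a : Fin q) : h.eps hS j (η a) = 0 := by simp [eps_apply, F'.dθ_η]
theorem nab_θ (k j : Fin n) : h.nab hS k (F.θ j) = 0 := by simp [nab_apply, F.dx_θ]
theorem eps_x (j k : Fin n) : h.eps hS j (F'.x k) = 0 := by simp [eps_apply, F'.dθ_x]

theorem nab_x (k l : Fin n) : h.nab hS k (F'.x l) = if l = k then 1 else 0 := by
  rw [← h.sum_D_mul_G hS, nab_apply]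
  exact Finset.sum_congr rfl fun i _ => by rw [← h.coe_D hS, hS.coe_comm]

theorem eps_θ (j i : Fin n) : h.eps hS j (F.θ i) = if j = i then 1 else 0 := by
  rw [← h.sum_G_mul_D hS, eps_apply]
  exact Finset.sum_congr rfl fun k _ => by rw [h.coe_D' hS]

theorem nab_x_self (k j : Fin n) : h.nab hS k (F.x j) = h.G hS j k := by
  simp [nab_apply, F.dx_x]

/-- The equations `∑ᵢ fᵢ ∂x'ᵏ/∂xⁱ = 0` have only the trivial solution, since `D` is invertible. -/
theorem eq_zero_of_sum (h : DarbouxRel F F') (hS : IsSuperComm α) {f : Fin n → R} (hf : ∀ k, ∑ i, f i * F.dx i (F'.x k) = 0) (i : Fin n) :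
    f i = 0 := by
  have h1 : ∑ k, (∑ j, f j * F.dx j (F'.x k)) * (h.G hS i k : R) = f i := by
    simp_rw [Finset.sum_mul, ← h.coe_D hS, mul_assoc]
    rw [Finset.sum_comm]
    have hc : ∀ j k, (h.D hS k j : R) * h.G hS i k = h.G hS i k * h.D hS k j := fun j k =>
      hS.coe_comm _ _
    simp_rw [hc, ← Finset.mul_sum, h.sum_G_mul_D]
    simp
  rw [← h1]
  simp [hf]

/-- Even derivations are determined by their values on the mixed coordinates `(x', θ)`. -/
theorem even_ext (h : DarbouxRel F F') (hS : IsSuperComm α) {X : R →ₗ[ℝ] R} (hX : IsEvenDer α X) (hx : ∀ i, X (F'.x i) = 0)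
    (hθ : ∀ i, X (F.θ i) = 0) (hη : ∀ a, X (η a) = 0) : X = 0 := by
  refine F.even_ext X hX (h.eq_zero_of_sum hS fun k => ?_) hθ hη
  rw [← hx k, F.even_chain hS hX hη (F'.x k)]
  simp [hθ]

/-- Odd derivations are determined by their values on the mixed coordinates `(x', θ)`. -/
theorem odd_ext (h : DarbouxRel F F') (hS : IsSuperComm α) {X : R →ₗ[ℝ] R} (hX : IsOddDer α X) (hx : ∀ i, X (F'.x i) = 0)
    (hθ : ∀ i, X (F.θ i) = 0) (hη : ∀ a, X (η a) = 0) : X = 0 := by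
  refine F.odd_ext X hX (h.eq_zero_of_sum hS fun k => ?_) hθ hη
  rw [← hx k, F.odd_chain hS hX hη (F'.x k)]
  simp [hθ]

theorem nab_comm (k l : Fin n) (f : R) :
    h.nab hS k (h.nab hS l f) = h.nab hS l (h.nab hS k f) := by
  have e := h.even_ext hS ((h.nab_der hS k).commutator (h.nab_der hS l))
    (fun m => by simp [nab_x, (h.nab_der hS _).map_ite]) (fun m => by simp [nab_θ])
    (fun a => by simp [nab_η])
  simpa [sub_eq_zero] using LinearMap.congr_fun e f

theorem eps_nab_comm (j k : Fin n) (f : R) :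
    h.eps hS j (h.nab hS k f) = h.nab hS k (h.eps hS j f) := by
  have e := h.odd_ext hS ((h.eps_der hS j).commutator (h.nab_der hS k))
    (fun m => by simp [nab_x, eps_x, (h.eps_der hS _).map_ite])
    (fun m => by simp [nab_θ, eps_θ, (h.nab_der hS _).map_ite])
    (fun a => by simp [nab_η, eps_η])
  simpa [sub_eq_zero] using LinearMap.congr_fun e f

theorem dθ_eq (i : Fin n) (f : R) :
    F.dθ i f = h.eps hS i f - ∑ m, h.eps hS i (F.x m) * F.dx m f := by
  rw [F.odd_chain hS (h.eps_der hS i) (h.eps_η hS i) f]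
  simp [eps_θ]

theorem dx_eq (j : Fin n) (f : R) : F.dx j f = ∑ k, (h.D hS k j : R) * h.nab hS k f := by
  simp_rw [nab_apply, Finset.mul_sum]
  rw [Finset.sum_comm]
  simp_rw [← mul_assoc, ← Finset.sum_mul, hS.coe_comm (h.D hS _ _), h.sum_G_mul_D]
  simp

theorem dθ'_eq (k : Fin n) (f : R) : F'.dθ k f = ∑ j, (h.D hS k j : R) * h.eps hS j f := by
  simp_rw [eps_apply, Finset.mul_sum]
  rw [Finset.sum_comm]
  simp_rw [← mul_assoc, ← Finset.sum_mul, h.sum_D_mul_G]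
  simp

/-- The derivatives `∂xʲ/∂θᵢ` in the mixed coordinates are antisymmetric, as the `x'ᵏ` commute with
respect to the bracket. -/
theorem eps_x_antisymm (i j : Fin n) : h.eps hS i (F.x j) = -h.eps hS j (F.x i) := by
  -- the chain rule for `∂/∂θᵢ`, applied to `x'ᵏ`, on which `εᵢ` vanishes
  have e : ∀ i k, ∑ m, h.eps hS i (F.x m) * F.dx m (F'.x k) = -F'.dθ k (F.x i) := by
    intro i k
    have := h.dθ_eq hS i (F'.x k)
    rw [h.eps_x, zero_sub, h.dθ_x] at this
    rw [this, neg_neg]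
  have e2 := h.eq_zero_of_sum hS (f := fun m => h.eps hS i (F.x m) + h.eps hS m (F.x i))
    (fun k => by
      simp only [add_mul, Finset.sum_add_distrib, e]
      rw [neg_add_eq_zero, h.dθ'_eq hS k]
      exact Finset.sum_congr rfl fun m _ => by rw [hS.coe_comm, h.coe_D])
  exact eq_neg_of_add_eq_zero_left (e2 j)

/-- The change of coordinates, as a mixed frame. -/
def mixedFrame : MixedFrame n hS.even R where
  d k := (h.nab_der hS k).toDerivation hS
  e j := (h.eps_der hS j).toDerivation hS
  dR := h.nab hS
  eR := h.eps hS
  dR_smul k a r := (h.nab_der hS k).map_mul a r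
  eR_smul j a r := by
    have := (h.eps_der hS j).map_mul a r
    rw [hS.mem_even.mp a.2] at this
    exact this
  dR_mul k := (h.nab_der hS k).map_mul
  d_comm k l a := Subtype.ext (h.nab_comm hS k l a)
  e_d j k a := h.eps_nab_comm hS j k a
  eR_dR j k r := h.eps_nab_comm hS j k r
  x j := ⟨F.x j, F.par_x j⟩
  D := h.D hS
  D_mul := by
    rw [← h.D_mul_G hS]
    congr 1
    ext j k
    exact h.nab_x_self hS k j
  anti := h.eps_x_antisymm hS

theorem mixedFrame_G : (h.mixedFrame hS).G = h.G hS := by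
  ext j k
  exact h.nab_x_self hS k j

/-- The unprimed Laplacian in the mixed coordinates. -/
theorem lap_eq (f : R) : F.lap f = ∑ j, h.eps hS j (∑ k, h.D hS k j • h.nab hS k f) := by
  have e : ∀ j, ∑ k, h.D hS k j • h.nab hS k f = F.dx j f := fun j => (h.dx_eq hS j f).symm
  simp_rw [e, F.lap_apply, ← F.dθ_dx_comm, h.dθ_eq hS, Finset.sum_sub_distrib]
  rw [sub_eq_self]
  refine sum_eq_zero_of_antisymm fun i j => ?_
  rw [h.eps_x_antisymm, F.dx_comm, neg_mul]

/-- The coefficients of the operators `∂/∂θ'ₗ` in the difference of `∂/∂x'ᵏ` in the coordinates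
`(x', θ')` and `∂/∂x'ᵏ` in the mixed coordinates `(x', θ)`. -/
def S (k l : Fin n) : R := ∑ j, F'.dx k (F.θ j) * h.G hS j l

theorem dx'_eq (k : Fin n) (f : R) :
    F'.dx k f = h.nab hS k f + ∑ l, h.S hS k l * F'.dθ l f := by
  have par : ∀ j, α (F'.dx k (F.θ j)) = -F'.dx k (F.θ j) := fun j => by
    rw [(F'.dx_der k).map_par, F.par_θ, map_neg]
  have e := h.even_ext hS (X := F'.dx k - (h.nab hS k + ∑ j, mulOp (F'.dx k (F.θ j)) (h.eps hS j)))
    ((F'.dx_der k).sub ((h.nab_der hS k).add (.sum fun j => (h.eps_der hS j).odd_mul hS (par j))))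
    (fun m => by simp [nab_x, eps_x, F'.dx_x, eq_comm])
    (fun m => by simp [nab_θ, eps_θ]) (fun a => by simp [nab_η, eps_η, F'.dx_η])
  have e2 := LinearMap.congr_fun e f
  simp only [LinearMap.sub_apply, LinearMap.add_apply, LinearMap.sum_apply, mulOp_apply,
    LinearMap.zero_apply, sub_eq_zero] at e2
  rw [e2]
  simp_rw [S, eps_apply, Finset.mul_sum, Finset.sum_mul, mul_assoc]
  rw [Finset.sum_comm]

/-- The matrix `S` is symmetric because of `{θᵢ, θⱼ} = 0`. -/
theorem S_symm (k l : Fin n) : h.S hS k l = h.S hS l k := by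
  let B : Matrix (Fin n) (Fin n) R := Matrix.of fun k j => F'.dx k (F.θ j)
  let D' : Matrix (Fin n) (Fin n) R := (h.D hS).map (↑)
  let G' : Matrix (Fin n) (Fin n) R := (h.G hS).map (↑)
  -- `{θⱼ, θᵢ} = 0` in the primed coordinates
  have e : (h.D hS).transpose.map (↑) * B = B.transpose * D' := by
    ext j i
    have e1 := F'.even_chain hS (F.dx_der j) (F.dx_η j) (F.θ i)
    simp only [F.dx_θ, h.dx_θ, ← h.dx_x, neg_mul, Finset.sum_neg_distrib] at e1
    exact eq_of_sub_eq_zero ((sub_eq_add_neg _ _).trans e1.symm)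
  have e2 : B * G' = (h.G hS).transpose.map (↑) * B.transpose := by
    calc B * G' = (h.G hS).transpose.map (↑) * ((h.D hS).transpose.map (↑) * B) * G' := by
          rw [← mul_assoc, hS.map_coe_mul, ← Matrix.transpose_mul, h.D_mul_G, Matrix.transpose_one,
            hS.map_coe_one, one_mul]
      _ = (h.G hS).transpose.map (↑) * B.transpose * (D' * G') := by
          rw [e]; simp only [mul_assoc]
      _ = _ := by rw [hS.map_coe_mul, h.D_mul_G, hS.map_coe_one, mul_one]
  have e3 := congrFun (congrFun e2 k) l
  rw [Matrix.mul_apply, Matrix.mul_apply] at e3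
  rw [S, S]
  refine e3.trans (Finset.sum_congr rfl fun j _ => hS.coe_comm _ _)

/-- The primed Laplacian in the mixed coordinates. -/
theorem lap'_eq (f : R) : F'.lap f = ∑ k, h.nab hS k (∑ j, h.D hS k j • h.eps hS j f) := by
  have e : ∀ k, ∑ j, h.D hS k j • h.eps hS j f = F'.dθ k f := fun k => (h.dθ'_eq hS k f).symm
  simp_rw [e, F'.lap_apply, h.dx'_eq hS, Finset.sum_add_distrib]
  rw [add_eq_left]
  refine sum_eq_zero_of_antisymm fun i j => ?_
  rw [h.S_symm, F'.dθ_anticomm hS, mul_neg]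

/-- The invariance of the odd Laplacian, up to the sign of the square root of the Berezinian. -/
theorem lap'_det_mul (s : R) : F'.lap ((h.G hS).det * s) = (h.G hS).det * F.lap s := by
  have := (h.mixedFrame hS).sum_dR_eR s
  rw [mixedFrame_G] at this
  rw [h.lap_eq hS, h.lap'_eq hS]
  exact this

/-- The Berezinian of a change of Darboux coordinates is a square: the Schur complement of its odd-odd
block `D` is the transpose of `D⁻¹`. -/
theorem ber_eq :
    ber (Matrix.of fun i j => F'.dx i (F.x j)) (Matrix.of fun i j => F'.dx i (F.θ j))
      (Matrix.of fun i j => F'.dθ i (F.x j)) (Matrix.of fun i j => F'.dθ i (F.θ j)) =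
    ((h.G hS).det : R) * (h.G hS).det := by
  have hD : (Matrix.of fun i j => F'.dθ i (F.θ j)) = (h.D hS).map ((↑) : hS.even → R) := by
    ext i j
    exact (h.coe_D' hS i j).symm
  have inv_eq : ∀ {A : Type _} [Ring A] {a b : A}, a * b = 1 → b * a = 1 → Ring.inverse a = b :=
    fun {A} _ {a b} h1 h2 => Ring.inverse_unit ⟨a, b, h1, h2⟩
  have hG : Ring.inverse ((h.D hS).map ((↑) : hS.even → R)) = (h.G hS).map (↑) :=
    inv_eq (by rw [hS.map_coe_mul, D_mul_G, hS.map_coe_one]) (by rw [hS.map_coe_mul, G_mul_D, hS.map_coe_one])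
  have hdet : Ring.inverse ((h.D hS).det : R) = (h.G hS).det := by
    have e1 := congrArg Matrix.det (h.D_mul_G hS)
    have e2 := congrArg Matrix.det (h.G_mul_D hS)
    rw [Matrix.det_mul, Matrix.det_one] at e1 e2
    exact inv_eq (by exact_mod_cast e1) (by exact_mod_cast e2)
  -- the Schur complement
  have hA : (Matrix.of fun i j => F'.dx i (F.x j)) - (Matrix.of fun i j => F'.dx i (F.θ j)) *
      (h.G hS).map (↑) * (Matrix.of fun i j => F'.dθ i (F.x j)) =
      (h.G hS).transpose.map ((↑) : hS.even → R) := by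
    ext i j
    rw [Matrix.sub_apply, Matrix.mul_apply, Matrix.of_apply, h.dx'_eq hS, nab_x_self]
    simp only [Matrix.mul_apply, Matrix.of_apply, Matrix.map_apply, Matrix.transpose_apply]
    exact add_sub_cancel_right _ _
  rw [ber, hD, hG, hA, ldet_coe, ldet_coe, hdet, Matrix.det_transpose]

theorem isUnit_det : IsUnit ((h.G hS).det : R) := by
  have e := (Matrix.isUnit_iff_isUnit_det _).mp (IsUnit.of_mul_eq_one _ (h.G_mul_D hS))
  exact e.map hS.even.val

end DarbouxRel

end Frame

/-! ### Derivations of algebras of smooth functions -/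

open Filter Topology in
theorem hasFDerivAt_parametric_integral {E G : Type*} [NormedAddCommGroup E] [NormedSpace ℝ E]
    [ProperSpace E] [NormedAddCommGroup G] [NormedSpace ℝ G] [CompleteSpace G] {F : E × ℝ → G}
    (hF : ContDiff ℝ ∞ F) (x₀ : E) :
    HasFDerivAt (fun x => ∫ t in (0 : ℝ)..1, F (x, t))
      (∫ t in (0 : ℝ)..1, (fderiv ℝ F (x₀, t)).comp (ContinuousLinearMap.inl ℝ E ℝ)) x₀ := by
  have hF' : Continuous fun p : E × ℝ => (fderiv ℝ F p).comp (ContinuousLinearMap.inl ℝ E ℝ) :=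
    (hF.continuous_fderiv (by simp)).clm_comp continuous_const
  obtain ⟨C, hC⟩ := ((isCompact_closedBall x₀ 1).prod (isCompact_Icc (a := (0 : ℝ))
    (b := 1))).exists_bound_of_continuousOn hF'.continuousOn
  refine (intervalIntegral.hasFDerivAt_integral_of_dominated_of_fderiv_le
    (F := fun x t => F (x, t)) (bound := fun _ => C)
    (F' := fun x t => (fderiv ℝ F (x, t)).comp (ContinuousLinearMap.inl ℝ E ℝ))
    (Metric.ball_mem_nhds x₀ one_pos) ?_ ?_ ?_ ?_ ?_ ?_)
  · exact Eventually.of_forall fun x =>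
      (hF.continuous.comp (Continuous.prodMk_right x)).aestronglyMeasurable
  · exact (hF.continuous.comp (Continuous.prodMk_right x₀)).intervalIntegrable _ _
  · exact (hF'.comp (Continuous.prodMk_right x₀)).aestronglyMeasurable
  · refine Eventually.of_forall fun t ht x hx => hC (x, t) ⟨Metric.ball_subset_closedBall hx, ?_⟩
    rw [Set.uIoc_of_le zero_le_one] at ht
    exact Set.Ioc_subset_Icc_self ht
  · exact intervalIntegrable_const
  · refine Eventually.of_forall fun t ht x hx => ?_
    exact ((hF.differentiable (by simp)) (x, t)).hasFDerivAt.comp x (hasFDerivAt_prodMk_left x t)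

/-- The induction on the order of differentiability changes the target space, so that the universe
levels of both spaces have to agree. -/
theorem contDiff_parametric_integral_nat (n : ℕ) {E : Type} [NormedAddCommGroup E]
    [NormedSpace ℝ E] [ProperSpace E] : ∀ {G : Type} [NormedAddCommGroup G] [NormedSpace ℝ G]
    [CompleteSpace G] {F : E × ℝ → G}, ContDiff ℝ ∞ F →
    ContDiff ℝ n (fun x => ∫ t in (0 : ℝ)..1, F (x, t)) := by
  induction n with
  | zero =>
    intro G _ _ _ F hF
    exact contDiff_zero.mpr (Differentiable.continuous (𝕜 := ℝ) fun x =>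
      (hasFDerivAt_parametric_integral hF x).differentiableAt)
  | succ n ih =>
    intro G _ _ _ F hF
    exact contDiff_succ_iff_hasFDerivAt.mpr ⟨_, ih ((hF.fderiv_right (m := ∞) le_rfl).clm_comp
      contDiff_const), hasFDerivAt_parametric_integral hF⟩

theorem contDiff_parametric_integral {E G : Type} [NormedAddCommGroup E]
    [NormedSpace ℝ E] [ProperSpace E] [NormedAddCommGroup G] [NormedSpace ℝ G]
    [CompleteSpace G] {F : E × ℝ → G} (hF : ContDiff ℝ ∞ F) :
    ContDiff ℝ ∞ (fun x => ∫ t in (0 : ℝ)..1, F (x, t)) :=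
  contDiff_infty.mpr fun n => contDiff_parametric_integral_nat n hF

/-- Hadamard's lemma. -/
theorem exists_hadamard {n : ℕ} {f : (Fin n → ℝ) → ℝ} (hf : ContDiff ℝ ∞ f) (p : Fin n → ℝ) :
    ∃ g : Fin n → (Fin n → ℝ) → ℝ, (∀ i, ContDiff ℝ ∞ (g i)) ∧
      ∀ x, f x = f p + ∑ i, (x i - p i) * g i x := by
  let c : (Fin n → ℝ) × ℝ → (Fin n → ℝ) := fun y => p + y.2 • (y.1 - p)
  have hc : ContDiff ℝ ∞ c :=
    contDiff_const.add (contDiff_snd.smul (contDiff_fst.sub contDiff_const))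
  have hdf : ContDiff ℝ ∞ (fderiv ℝ f) := hf.fderiv_right le_rfl
  have hF : ∀ i, ContDiff ℝ ∞ fun y => fderiv ℝ f (c y) (Pi.single i (1 : ℝ)) := fun i =>
    (hdf.comp hc).clm_apply contDiff_const
  refine ⟨fun i x => ∫ t in (0 : ℝ)..1, fderiv ℝ f (c (x, t)) (Pi.single i 1),
    fun i => contDiff_parametric_integral (hF i), fun x => ?_⟩
  have h1 : ∀ t ∈ Set.uIcc (0 : ℝ) 1, HasDerivAt (fun t => f (c (x, t)))
      (fderiv ℝ f (c (x, t)) (x - p)) t := by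
    intro t _
    have hct : HasDerivAt (fun t => c (x, t)) (x - p) t := by
      simpa [c] using ((hasDerivAt_id t).smul_const (x - p)).const_add p
    exact ((hf.differentiable (by simp)) _).hasFDerivAt.comp_hasDerivAt t hct
  have hcont : Continuous fun t => fderiv ℝ f (c (x, t)) (x - p) :=
    ((hdf.comp hc).continuous.comp (Continuous.prodMk_right x)).clm_apply continuous_const
  have h2 := intervalIntegral.integral_eq_sub_of_hasDerivAt h1 (hcont.intervalIntegrable _ _)
  have h3 : c (x, 1) = x := by simp [c]
  have h4 : c (x, 0) = p := by simp [c]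
  simp only [h3, h4] at h2
  rw [eq_sub_iff_add_eq, add_comm] at h2
  rw [← h2]
  congr 1
  have h5 : ∀ t, fderiv ℝ f (c (x, t)) (x - p) =
      ∑ i, (x i - p i) * fderiv ℝ f (c (x, t)) (Pi.single i 1) := by
    intro t
    conv_lhs => rw [pi_eq_sum_univ' (x - p), map_sum]
    simp only [map_smul, smul_eq_mul, Pi.sub_apply]
  simp_rw [h5]
  rw [intervalIntegral.integral_finsetSum]
  · simp_rw [intervalIntegral.integral_const_mul]
  · exact fun i _ => (continuous_const.mul
      ((hF i).continuous.comp (Continuous.prodMk_right x))).intervalIntegrable _ _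

/-- Restriction of a smooth function on `ℝⁿ` to an open set. -/
def smoothOf {n : ℕ} (V : Opens (Fin n → ℝ)) {f : (Fin n → ℝ) → ℝ} (hf : ContDiff ℝ ∞ f) :
    smoothFun V :=
  ⟨fun x => f x, by
    intro x
    refine hf.contDiffAt.congr_of_eventuallyEq ?_
    filter_upwards [V.isOpen.mem_nhds x.2] with y hy
    exact extend_apply _ hy⟩

theorem smoothFun_ext {n : ℕ} {V : Opens (Fin n → ℝ)} {f g : smoothFun V}
    (h : ∀ p, (f : V → ℝ) p = (g : V → ℝ) p) : f = g := Subtype.ext (funext h)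

theorem smoothDeriv_apply {n : ℕ} (V : Opens (Fin n → ℝ)) (i : Fin n) (f : smoothFun V) (p : V) :
    (smoothDeriv V i f : V → ℝ) p =
      fderiv ℝ (Function.extend Subtype.val (f : V → ℝ) 0) p (Pi.single i 1) := rfl

/-- The product of a smooth function on `V` with a suitable bump function `χ` at a point of `V`
extends to a smooth function on the whole space. -/
theorem exists_bump {n : ℕ} (V : Opens (Fin n → ℝ)) (f : smoothFun V) (p : V) :
    ∃ χ : (Fin n → ℝ) → ℝ, ∃ hχ : ContDiff ℝ ∞ χ, ∃ F : (Fin n → ℝ) → ℝ, ∃ hF : ContDiff ℝ ∞ F,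
      χ p = 1 ∧ smoothOf V hF = smoothOf V hχ * f := by
  obtain ⟨χ, hs, -, hχ, -, h1⟩ := exists_contDiff_tsupport_subset (n := ⊤)
    (V.isOpen.mem_nhds p.2)
  refine ⟨χ, hχ, fun x => χ x * Function.extend Subtype.val (f : V → ℝ) 0 x, ?_, h1, ?_⟩
  · rw [contDiff_iff_contDiffAt]
    intro x
    by_cases hx : x ∈ V
    · exact hχ.contDiffAt.mul (f.2 ⟨x, hx⟩)
    · have hx' : x ∉ tsupport χ := fun h => hx (hs h)
      refine (contDiffAt_const (c := (0 : ℝ))).congr_of_eventuallyEq ?_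
      filter_upwards [(isClosed_tsupport χ).isOpen_compl.mem_nhds hx'] with y hy
      rw [image_eq_zero_of_notMem_tsupport hy, zero_mul]
  · refine smoothFun_ext fun x => ?_
    change χ x * Function.extend Subtype.val (f : V → ℝ) 0 x = χ x * (f : V → ℝ) x
    rw [extend_apply _ x.2]

theorem smoothDeriv_mul {n : ℕ} (V : Opens (Fin n → ℝ)) (i : Fin n) (f g : smoothFun V) :
    smoothDeriv V i (f * g) = smoothDeriv V i f * g + f * smoothDeriv V i g := by
  refine smoothFun_ext fun p => ?_
  have hf := (f.2 p).differentiableAt (by simp)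
  have hg := (g.2 p).differentiableAt (by simp)
  have h : Function.extend Subtype.val ((f * g : smoothFun V) : V → ℝ) (0 : (Fin n → ℝ) → ℝ) =
      Function.extend Subtype.val (f : V → ℝ) 0 * Function.extend Subtype.val (g : V → ℝ) 0 := by
    simpa using Function.extend_mul (Subtype.val : V → Fin n → ℝ) (f : V → ℝ) (g : V → ℝ) 0 0
  have h2 : (smoothDeriv V i (f * g) : V → ℝ) p = (smoothDeriv V i f : V → ℝ) p * (g : V → ℝ) p +
      (f : V → ℝ) p * (smoothDeriv V i g : V → ℝ) p := by
    rw [smoothDeriv_apply, h, fderiv_mul hf hg]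
    simp only [extend_apply _ p.2, smoothDeriv_apply]
    simp [mul_comm, add_comm]
  exact h2

theorem smoothDeriv_coord {n : ℕ} (V : Opens (Fin n → ℝ)) (i j : Fin n) :
    smoothDeriv V i (smoothCoord V j) = if i = j then 1 else 0 := by
  refine smoothFun_ext fun p => ?_
  rw [smoothDeriv_apply]
  have h : Function.extend Subtype.val (smoothCoord V j : V → ℝ) 0 =ᶠ[nhds (p : Fin n → ℝ)]
      fun x => x j := by
    filter_upwards [V.isOpen.mem_nhds p.2] with y hy
    exact extend_apply _ hy
  rw [h.fderiv_eq, (hasFDerivAt_apply j (p : Fin n → ℝ)).fderiv]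
  split_ifs with hij
  · subst hij
    exact Pi.single_eq_same _ _
  · exact Pi.single_eq_of_ne' hij _

theorem smoothDeriv_res {n : ℕ} {V W : Opens (Fin n → ℝ)} (h : W ≤ V) (i : Fin n)
    (f : smoothFun V) : smoothDeriv W i (smoothRes h f) = smoothRes h (smoothDeriv V i f) := by
  refine smoothFun_ext fun p => ?_
  refine congrArg (fun L : (Fin n → ℝ) →L[ℝ] ℝ => L (Pi.single i 1))
    (Filter.EventuallyEq.fderiv_eq ?_)
  filter_upwards [W.isOpen.mem_nhds p.2] with y hy
  rw [extend_apply _ hy, extend_apply _ (h hy)]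
  rfl

/-- A derivation of `C^∞(V)` which annihilates the coordinates is zero: by Hadamard's lemma it
annihilates the functions which are smooth on `ℝⁿ`, and a bump function reduces to these. -/
theorem smooth_derivation_eq_zero {n : ℕ} {V : Opens (Fin n → ℝ)}
    (d : Derivation ℝ (smoothFun V) (smoothFun V)) (hd : ∀ i, d (smoothCoord V i) = 0) : d = 0 := by
  have glob : ∀ (F : (Fin n → ℝ) → ℝ) (hF : ContDiff ℝ ∞ F) (p : V),
      (d (smoothOf V hF) : V → ℝ) p = 0 := by
    intro F hF p
    obtain ⟨g, hg, h1⟩ := exists_hadamard hF p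
    have e : smoothOf V hF = algebraMap ℝ _ (F p) +
        ∑ i, (smoothCoord V i - algebraMap ℝ _ ((p : Fin n → ℝ) i)) * smoothOf V (hg i) := by
      refine smoothFun_ext fun x => (h1 x).trans ?_
      simp only [AddMemClass.coe_add, AddSubmonoidClass.coe_finsetSum, Pi.add_apply,
        Finset.sum_apply]
      rfl
    rw [e, map_add, d.map_algebraMap, zero_add, map_sum]
    simp only [AddSubmonoidClass.coe_finsetSum, Finset.sum_apply]
    refine Finset.sum_eq_zero fun i _ => ?_
    rw [d.leibniz, map_sub, hd, d.map_algebraMap, sub_zero, smul_zero, add_zero]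
    change ((p : Fin n → ℝ) i - (p : Fin n → ℝ) i) * _ = 0
    rw [sub_self, zero_mul]
  refine Derivation.ext fun f => smoothFun_ext fun p => ?_
  obtain ⟨χ, hχ, F, hF, h1, h2⟩ := exists_bump V f p
  have h3 := congrArg (fun a : smoothFun V => (a : V → ℝ) p) (congrArg d h2)
  simp only [Derivation.leibniz, glob] at h3
  have h4 : (0 : ℝ) = χ p * (d f : V → ℝ) p + (f : V → ℝ) p * (d (smoothOf V hχ) : V → ℝ) p := h3
  rw [glob, h1, one_mul, mul_zero, add_zero] at h4
  exact h4.symm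

/-! ### Functions on superdomains -/

section Grassmann

variable {W : Type*} [AddCommGroup W] [Module ℝ W]

local notation "inv" => (CliffordAlgebra.involute : ExteriorAlgebra ℝ W →ₐ[ℝ] ExteriorAlgebra ℝ W)

theorem involute_ι' (w : W) : inv (ExteriorAlgebra.ι ℝ w) = -ExteriorAlgebra.ι ℝ w :=
  CliffordAlgebra.involute_ι _

/-- Supercommutativity of the exterior algebra, for a factor of degree one. -/
theorem ι_mul_eq_involute_mul_ι (w : W) (a : ExteriorAlgebra ℝ W) :
    ExteriorAlgebra.ι ℝ w * a = inv a * ExteriorAlgebra.ι ℝ w := by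
  induction a using ExteriorAlgebra.induction with
  | algebraMap r => rw [AlgHom.commutes, Algebra.commutes]
  | ι x =>
    rw [involute_ι', neg_mul]
    exact eq_neg_of_add_eq_zero_left (ExteriorAlgebra.ι_add_mul_swap w x)
  | mul a b ha hb => rw [← mul_assoc, ha, mul_assoc, hb, map_mul, mul_assoc]
  | add a b ha hb => rw [mul_add, ha, hb, map_add, add_mul]

/-- The left contraction with a linear form, for the exterior algebra as the Clifford algebra of the
zero form. -/
def contract (d : Module.Dual ℝ W) : ExteriorAlgebra ℝ W →ₗ[ℝ] ExteriorAlgebra ℝ W :=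
  CliffordAlgebra.contractLeft d

theorem contract_ι_mul (d : Module.Dual ℝ W) (w : W) (b : ExteriorAlgebra ℝ W) :
    contract d (ExteriorAlgebra.ι ℝ w * b) = d w • b - ExteriorAlgebra.ι ℝ w * contract d b :=
  CliffordAlgebra.contractLeft_ι_mul (Q := (0 : QuadraticForm ℝ W)) d w b

theorem contract_algebraMap (d : Module.Dual ℝ W) (r : ℝ) :
    contract d (algebraMap ℝ (ExteriorAlgebra ℝ W) r) = 0 :=
  CliffordAlgebra.contractLeft_algebraMap (Q := (0 : QuadraticForm ℝ W)) d r

theorem contract_ι (d : Module.Dual ℝ W) (w : W) :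
    contract d (ExteriorAlgebra.ι ℝ w) = algebraMap ℝ _ (d w) :=
  CliffordAlgebra.contractLeft_ι (Q := (0 : QuadraticForm ℝ W)) d w

theorem contract_mul (d : Module.Dual ℝ W) (a b : ExteriorAlgebra ℝ W) :
    contract d (a * b) = contract d a * b + inv a * contract d b := by
  induction a using ExteriorAlgebra.induction generalizing b with
  | algebraMap r =>
    rw [contract_algebraMap, AlgHom.commutes, zero_mul, zero_add, ← Algebra.smul_def, map_smul,
      Algebra.smul_def]
  | ι x => rw [contract_ι_mul, contract_ι, involute_ι', neg_mul, Algebra.smul_def, sub_eq_add_neg]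
  | mul a c ha hc =>
    rw [mul_assoc, ha, hc, ha, map_mul, add_mul, mul_add, mul_assoc, mul_assoc, mul_assoc,
      add_assoc]
  | add a c ha hc => rw [add_mul, map_add, map_add, map_add, ha, hc, add_mul, add_mul]; abel

theorem involute_contract (d : Module.Dual ℝ W) (a : ExteriorAlgebra ℝ W) :
    inv (contract d a) = -contract d (inv a) := by
  induction a using ExteriorAlgebra.induction with
  | algebraMap r => simp [contract_algebraMap]
  | ι x => rw [contract_ι, involute_ι', map_neg, contract_ι, neg_neg, AlgHom.commutes]
  | mul a c ha hc =>
    rw [contract_mul, map_add, map_mul, map_mul, ha, hc, map_mul, contract_mul]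
    simp only [neg_mul, mul_neg]
    abel
  | add a c ha hc => simp only [map_add, ha, hc]; abel

end Grassmann

theorem IsOddDer.of_add {R : Type*} [Ring R] [Algebra ℝ R] {α : R →ₐ[ℝ] R} {X : R →ₗ[ℝ] R}
    (h : ∀ f g, X (f * g) = X f * g + α f * X g) (h' : ∀ f, α (X f) + X (α f) = 0) :
    IsOddDer α X :=
  ⟨h, fun f => eq_neg_of_add_eq_zero_left (h' f)⟩

/-- Supercommutativity can be checked on generators: a set `S` of even elements and a set `O` of odd
elements which satisfy the induction principle `ind`. -/
theorem IsSuperComm.of_induction {R : Type*} [Ring R] [Algebra ℝ R] {α : R →ₐ[ℝ] R} (S O : Set R)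
    (invol : ∀ f, α (α f) = f) (hS : ∀ s ∈ S, α s = s ∧ ∀ f, s * f = f * s)
    (hO : ∀ w ∈ O, α w = -w ∧ ∀ f, w * f = α f * w)
    (ind : ∀ C : R → Prop, (∀ s ∈ S, C s) → (∀ w ∈ O, C w) → (∀ f g, C f → C g → C (f * g)) →
      (∀ f g, C f → C g → C (f + g)) → ∀ f, C f) : IsSuperComm α where
  invol := invol
  even_comm a f ha := by
    refine ind (fun f => a * f = f * a) (fun s hs => ((hS s hs).2 a).symm)
      (fun w hw => by rw [(hO w hw).2, ha]) (fun f g hf hg => ?_) (fun f g hf hg => ?_) f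
    · rw [← mul_assoc, hf, mul_assoc, hg, mul_assoc]
    · rw [mul_add, hf, hg, add_mul]
  odd_anticomm a b ha hb := by
    have key : ∀ f, a * f = α f * a := by
      refine ind _ (fun s hs => ?_) (fun w hw => ?_) (fun f g hf hg => ?_) (fun f g hf hg => ?_)
      · rw [(hS s hs).1, (hS s hs).2]
      · rw [(hO w hw).1, neg_mul, (hO w hw).2, ha, neg_mul, neg_neg]
      · rw [← mul_assoc, hf, mul_assoc, hg, map_mul, mul_assoc]
      · rw [mul_add, hf, hg, map_add, add_mul]
    rw [key, hb, neg_mul]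

namespace SuperFun

variable {n q : ℕ} {V : Opens (Fin n → ℝ)}

/-- The linear function of the odd generators with the given coefficients. -/
def odd (V : Opens (Fin n → ℝ)) (w : Fin n ⊕ Fin q → ℝ) : SuperFun q V :=
  1 ⊗ₜ ExteriorAlgebra.ι ℝ w

/-- Functions on a superdomain are generated by the smooth functions and the odd generators. -/
theorem induction {C : SuperFun q V → Prop} (smooth : ∀ s : smoothFun V, C (s ⊗ₜ 1))
    (hodd : ∀ w, C (odd V w)) (mul : ∀ f g, C f → C g → C (f * g))
    (add : ∀ f g, C f → C g → C (f + g)) (f : SuperFun q V) : C f := by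
  have h1 : ∀ a : Grass n q, C (1 ⊗ₜ a) := by
    intro a
    induction a using ExteriorAlgebra.induction with
    | algebraMap r =>
      rw [Algebra.algebraMap_eq_smul_one, ← TensorProduct.smul_tmul]
      exact smooth _
    | ι x => exact hodd x
    | mul a b ha hb =>
      rw [← one_mul (1 : smoothFun V), ← Algebra.TensorProduct.tmul_mul_tmul]
      exact mul _ _ ha hb
    | add a b ha hb =>
      rw [TensorProduct.tmul_add]
      exact add _ _ ha hb
  induction f using TensorProduct.induction_on with
  | zero => simpa using smooth 0
  | tmul s a =>
    rw [← mul_one s, ← one_mul a, ← Algebra.TensorProduct.tmul_mul_tmul]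
    exact mul _ _ (smooth s) (h1 a)
  | add f g hf hg => exact add _ _ hf hg

@[simp] theorem par_tmul (s : smoothFun V) (a : Grass n q) :
    par V (s ⊗ₜ[ℝ] a) = s ⊗ₜ CliffordAlgebra.involute a := rfl

theorem par_odd (w : Fin n ⊕ Fin q → ℝ) : par V (odd V w) = -odd V w := by
  rw [odd, par_tmul]
  exact (congrArg _ (involute_ι' w)).trans (TensorProduct.tmul_neg _ _)

theorem smooth_comm (s : smoothFun V) (f : SuperFun q V) :
    (s ⊗ₜ[ℝ] (1 : Grass n q)) * f = f * (s ⊗ₜ 1) := by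
  induction f using TensorProduct.induction_on with
  | zero => simp
  | tmul t a => simp [mul_comm]
  | add f g hf hg => rw [mul_add, hf, hg, add_mul]

theorem odd_mul (w : Fin n ⊕ Fin q → ℝ) (f : SuperFun q V) :
    odd V w * f = par V f * odd V w := by
  induction f using TensorProduct.induction_on with
  | zero => simp
  | tmul t a =>
    rw [odd, par_tmul, Algebra.TensorProduct.tmul_mul_tmul, Algebra.TensorProduct.tmul_mul_tmul,
      mul_comm, ι_mul_eq_involute_mul_ι]
  | add f g hf hg => rw [mul_add, hf, hg, map_add, add_mul]

theorem isSuperComm : IsSuperComm (R := SuperFun q V) (par V) := by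
  refine .of_induction (Set.range fun s => s ⊗ₜ 1) (Set.range (odd V)) ?_ ?_ ?_ ?_
  · intro f
    induction f using TensorProduct.induction_on with
    | zero => simp
    | tmul t a =>
      rw [par_tmul, par_tmul]
      exact congrArg _ (CliffordAlgebra.involute_involute a)
    | add f g hf hg => rw [map_add, map_add, hf, hg]
  · rintro _ ⟨s, rfl⟩
    exact ⟨by simp, smooth_comm s⟩
  · rintro _ ⟨w, rfl⟩
    exact ⟨par_odd w, odd_mul w⟩
  · intro C hs ho hm ha f
    exact SuperFun.induction (fun s => hs _ ⟨s, rfl⟩) (fun w => ho _ ⟨w, rfl⟩) hm ha f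

@[simp] theorem dx_tmul (i : Fin n) (s : smoothFun V) (a : Grass n q) :
    dx V i (s ⊗ₜ[ℝ] a) = smoothDeriv V i s ⊗ₜ a := rfl

@[simp] theorem dθ_tmul (i : Fin n) (s : smoothFun V) (a : Grass n q) :
    dθ V i (s ⊗ₜ[ℝ] a) = s ⊗ₜ contract (LinearMap.proj (Sum.inl i)) a := rfl

theorem dx_der (i : Fin n) : IsEvenDer (R := SuperFun q V) (par V) (dx V i) where
  map_mul f g := by
    induction f using TensorProduct.induction_on with
    | zero => simp
    | add f f' hf hf' => rw [add_mul, map_add, map_add, hf, hf', add_mul, add_mul]; abel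
    | tmul s a =>
      induction g using TensorProduct.induction_on with
      | zero => simp
      | add f f' hf hf' => rw [mul_add, map_add, map_add, hf, hf', mul_add, mul_add]; abel
      | tmul t b => simp [smoothDeriv_mul, TensorProduct.add_tmul]
  map_par f := by
    induction f using TensorProduct.induction_on with
    | zero => simp
    | add f f' hf hf' => simp only [map_add, hf, hf']
    | tmul s a => simp

theorem dθ_der (i : Fin n) : IsOddDer (R := SuperFun q V) (par V) (dθ V i) := by
  refine .of_add (fun f g => ?_) fun f => ?_
  · induction f using TensorProduct.induction_on with
    | zero => simp
    | add f f' hf hf' => simp only [add_mul, map_add, hf, hf']; abel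
    | tmul s a =>
      induction g using TensorProduct.induction_on with
      | zero => simp
      | add f f' hf hf' => simp only [mul_add, map_add, hf, hf']; abel
      | tmul t b =>
        simp [contract_mul, TensorProduct.tmul_add]
  · induction f using TensorProduct.induction_on with
    | zero => simp
    | add f f' hf hf' =>
      simp only [map_add]
      rw [add_add_add_comm, hf, hf', add_zero]
    | tmul s a =>
      rw [par_tmul, dθ_tmul, dθ_tmul, par_tmul, ← TensorProduct.tmul_add]
      exact (congrArg _ (add_eq_zero_iff_eq_neg.mpr (involute_contract _ a))).trans
        (TensorProduct.tmul_zero _ _)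

/-- A derivation which annihilates the coordinates and the odd parameters is zero. Here `τ` is the
identity for an even derivation, and the parity involution for an odd one. -/
theorem der_eq_zero (τ : SuperFun q V →ₐ[ℝ] SuperFun q V) (hτ : ∀ s, τ (s ⊗ₜ 1) = s ⊗ₜ 1)
    (X : SuperFun q V →ₗ[ℝ] SuperFun q V) (hX : ∀ f g, X (f * g) = X f * g + τ f * X g)
    (hx : ∀ i, X (x V i) = 0) (hθ : ∀ i, X (θ V i) = 0) (hη : ∀ a, X (η V a) = 0) : X = 0 := by
  -- the odd linear functions are combinations of the `θᵢ` and the parameters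
  have hodd : ∀ w, X (odd V w) = 0 := by
    intro w
    have : odd V w = ∑ k, w k • (1 ⊗ₜ[ℝ] Grass.gen k : SuperFun q V) := by
      rw [odd]
      conv_lhs => rw [pi_eq_sum_univ' w, map_sum, TensorProduct.tmul_sum]
      refine Finset.sum_congr rfl fun k _ => ?_
      rw [map_smul, TensorProduct.tmul_smul]
      rfl
    rw [this, map_sum]
    refine Finset.sum_eq_zero fun k _ => ?_
    rw [map_smul]
    rcases k with i | a
    · exact (congrArg _ (hθ i)).trans (smul_zero _)
    · exact (congrArg _ (hη a)).trans (smul_zero _)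
  let b := Module.Basis.ofVectorSpace ℝ (Grass n q)
  let B := Algebra.TensorProduct.basis (smoothFun V) b
  have smul_eq : ∀ (s : smoothFun V) (f : SuperFun q V), s • f = (s ⊗ₜ 1) * f := by
    intro s f
    exact Algebra.smul_def s f
  -- on smooth functions, every coefficient of `X` in a basis of the Grassmann algebra is a derivation
  have hsm : ∀ s : smoothFun V, X (s ⊗ₜ 1) = 0 := by
    intro s
    refine B.repr.injective (Finsupp.ext fun k => ?_)
    let D : Derivation ℝ (smoothFun V) (smoothFun V) :=
      Derivation.mk' ((B.coord k).restrictScalars ℝ ∘ₗ X ∘ₗ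
        (TensorProduct.mk ℝ (smoothFun V) (Grass n q)).flip 1) fun s t => by
        have h1 : X ((s * t) ⊗ₜ 1) = s • X (t ⊗ₜ 1) + t • X (s ⊗ₜ 1) := by
          rw [smul_eq, smul_eq, smooth_comm t, add_comm]
          have := hX (s ⊗ₜ 1) (t ⊗ₜ 1)
          rw [hτ, Algebra.TensorProduct.tmul_mul_tmul, one_mul] at this
          exact this
        change B.coord k (X ((s * t) ⊗ₜ 1)) = _
        rw [h1, map_add, map_smul, map_smul]
        rfl
    have hD : D = 0 := smooth_derivation_eq_zero D fun i => by
      change B.coord k (X (x V i)) = 0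
      rw [hx, map_zero]
    rw [map_zero]
    exact congrArg (fun d : Derivation ℝ (smoothFun V) (smoothFun V) => d s) hD
  refine LinearMap.ext fun f => ?_
  induction f using SuperFun.induction with
  | smooth s => exact hsm s
  | hodd w => exact hodd w
  | mul f g hf hg =>
    rw [LinearMap.zero_apply] at *
    rw [hX, hf, hg, zero_mul, mul_zero, add_zero]
  | add f g hf hg => rw [map_add, hf, hg, map_add]

end SuperFun

/-! ### Invertible functions and signs -/

/-- An even element of a superalgebra is invertible if its body is, where the body is given by a
homomorphism `c` to the even elements that is the identity on the generators in `S` and zero on the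
odd generators in `O`. -/
theorem IsSuperComm.isUnit_of_isUnit_body {R : Type*} [Ring R] [Algebra ℝ R] {α : R →ₐ[ℝ] R}
    (hS : IsSuperComm α) (c : R →ₐ[ℝ] hS.even) (S O : Set R)
    (hcS : ∀ s ∈ S, (c s : R) = s) (hcO : ∀ w ∈ O, α w = -w ∧ c w = 0)
    (ind : ∀ C : R → Prop, (∀ s ∈ S, C s) → (∀ w ∈ O, C w) → (∀ f g, C f → C g → C (f * g)) →
      (∀ f g, C f → C g → C (f + g)) → ∀ f, C f)
    {f : R} (hf : α f = f) (hu : IsUnit (c f)) : IsUnit f := by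
  let e : R → hS.even := fun f => ⟨(2⁻¹ : ℝ) • (f + α f), by
    rw [hS.mem_even, map_smul, map_add, hS.invol, add_comm]⟩
  let o : R → R := fun f => (2⁻¹ : ℝ) • (f - α f)
  have ho : ∀ f, α (o f) = -o f := fun f => by
    rw [map_smul, map_sub, hS.invol, ← smul_neg, neg_sub]
  have he : ∀ f, α f = f → (e f : R) = f := fun f h => by
    change (2⁻¹ : ℝ) • (f + α f) = f
    rw [h]; module
  -- the even part and the body agree modulo nilpotents, as this holds on generators
  have key : ∀ f, e f - c f ∈ nilradical hS.even := by
    refine ind _ (fun s hs => ?_) (fun w hw => ?_) (fun f g hf hg => ?_) (fun f g hf hg => ?_)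
    · have : e s = c s := Subtype.ext <| by rw [hcS s hs, he]; rw [← hcS s hs]; exact (c s).2
      rw [this, sub_self]
      exact zero_mem _
    · have : e w = 0 := Subtype.ext <| by
        change (2⁻¹ : ℝ) • (w + α w) = 0
        rw [(hcO w hw).1, add_neg_cancel, smul_zero]
      rw [this, (hcO w hw).2, sub_self]
      exact zero_mem _
    · let oo : hS.even := ⟨o f * o g, by rw [hS.mem_even, map_mul, ho, ho, neg_mul_neg]⟩
      have h1 : e (f * g) = e f * e g + oo := Subtype.ext <| by
        change (2⁻¹ : ℝ) • (f * g + α (f * g)) = (2⁻¹ : ℝ) • (f + α f) * (2⁻¹ : ℝ) • (g + α g) +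
          (2⁻¹ : ℝ) • (f - α f) * (2⁻¹ : ℝ) • (g - α g)
        simp only [map_mul, smul_mul_assoc, mul_smul_comm, add_mul, mul_add, sub_mul, mul_sub]
        module
      have h2 : oo ∈ nilradical hS.even :=
        mem_nilradical.mpr (hS.isNilpotent_of_odd_mul_odd (ho f) (ho g) rfl)
      have h3 : e (f * g) - c (f * g) = e f * (e g - c g) + c g * (e f - c f) + oo := by
        rw [h1, map_mul]; ring
      rw [h3]
      exact add_mem (add_mem (Ideal.mul_mem_left _ _ hg) (Ideal.mul_mem_left _ _ hf)) h2
    · have h1 : e (f + g) = e f + e g := Subtype.ext <| by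
        change (2⁻¹ : ℝ) • (f + g + α (f + g)) = (2⁻¹ : ℝ) • (f + α f) + (2⁻¹ : ℝ) • (g + α g)
        rw [map_add]; module
      rw [h1, map_add, add_sub_add_comm]
      exact add_mem hf hg
  have h1 := (mem_nilradical.mp (key f)).isUnit_add_left_of_commute hu (Commute.all _ _)
  rw [add_sub_cancel] at h1
  exact he f hf ▸ h1.map hS.even.val

theorem smooth_isUnit_iff {n : ℕ} {V : Opens (Fin n → ℝ)} (f : smoothFun V) :
    IsUnit f ↔ ∀ p, (f : V → ℝ) p ≠ 0 := by
  constructor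
  · intro h p
    have := (h.map (smoothFun V).val).map (Pi.evalRingHom (fun _ : V => ℝ) p)
    exact this.ne_zero
  · intro h
    have hm : (fun p => ((f : V → ℝ) p)⁻¹) ∈ smoothFun V := by
      intro p
      have h1 := (f.2 p).inv (by rw [extend_apply _ p.2]; exact h p)
      refine h1.congr_of_eventuallyEq ?_
      filter_upwards [V.isOpen.mem_nhds p.2] with y hy
      simp [extend_apply _ hy]
    exact IsUnit.of_mul_eq_one ⟨_, hm⟩ (smoothFun_ext fun p => mul_inv_cancel₀ (h p))

/-- The sign of a nowhere vanishing smooth function is smooth. -/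
theorem exists_smooth_sign {n : ℕ} {V : Opens (Fin n → ℝ)} (g : smoothFun V)
    (hg : ∀ p, (g : V → ℝ) p ≠ 0) :
    ∃ ε : smoothFun V, ε * ε = 1 ∧ ∀ p, 0 < (ε : V → ℝ) p * (g : V → ℝ) p := by
  have hm : (fun p => Real.sign ((g : V → ℝ) p)) ∈ smoothFun V := by
    intro p
    have hc : ContinuousAt (Function.extend Subtype.val (g : V → ℝ) 0) (p : Fin n → ℝ) :=
      (g.2 p).continuousAt
    refine (contDiffAt_const (c := Real.sign ((g : V → ℝ) p))).congr_of_eventuallyEq ?_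
    have hgp := extend_apply (g : V → ℝ) p.2
    rcases (hg p).lt_or_gt with h | h
    · filter_upwards [V.isOpen.mem_nhds p.2, hc.eventually_lt_const (u := 0) (by rwa [hgp])]
        with y hy hy'
      rw [extend_apply _ hy] at *
      rw [Real.sign_of_neg h, Real.sign_of_neg hy']
    · filter_upwards [V.isOpen.mem_nhds p.2, hc.eventually_const_lt (u := 0) (by rwa [hgp])]
        with y hy hy'
      rw [extend_apply _ hy] at *
      rw [Real.sign_of_pos h, Real.sign_of_pos hy']
  refine ⟨⟨_, hm⟩, smoothFun_ext fun p => ?_, fun p => ?_⟩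
  · change Real.sign _ * Real.sign _ = 1
    rcases Real.sign_apply_eq_of_ne_zero _ (hg p) with h | h <;> rw [h] <;> norm_num
  · exact Real.sign_mul_pos_of_ne_zero _ (hg p)

/-! ### The coordinate frame of a superdomain -/

theorem smoothDeriv_one {n : ℕ} (V : Opens (Fin n → ℝ)) (i : Fin n) :
    smoothDeriv V i 1 = 0 := by
  have h := smoothDeriv_mul V i 1 1
  rw [one_mul, mul_one, one_mul] at h
  exact left_eq_add.mp h

namespace SuperFun

variable {n q : ℕ} {V W : Opens (Fin n → ℝ)}

theorem dx_res (h : W ≤ V) (i : Fin n) (f : SuperFun q V) :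
    dx W i (res h f) = res h (dx V i f) := by
  induction f using TensorProduct.induction_on with
  | zero => simp
  | add f g hf hg => simp only [map_add, hf, hg]
  | tmul s a => exact congrArg (fun t : smoothFun W => t ⊗ₜ[ℝ] a) (smoothDeriv_res h i s)

theorem dθ_res (h : W ≤ V) (i : Fin n) (f : SuperFun q V) :
    dθ W i (res h f) = res h (dθ V i f) := by
  induction f using TensorProduct.induction_on with
  | zero => simp
  | add f g hf hg => simp only [map_add, hf, hg]
  | tmul s a => rfl

theorem res_x (h : W ≤ V) (i : Fin n) : res h (x V i : SuperFun q V) = x W i := rfl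

theorem res_θ (h : W ≤ V) (i : Fin n) : res h (θ V i : SuperFun q V) = θ W i :=
  congrArg (fun t : smoothFun W => t ⊗ₜ[ℝ] (Grass.gen (Sum.inl i) : Grass n q))
    (map_one (smoothRes h))

@[simp] theorem body_tmul (s : smoothFun V) (a : Grass n q) :
    body V (s ⊗ₜ[ℝ] a) = ExteriorAlgebra.algebraMapInv a • s := rfl

theorem body_odd (w : Fin n ⊕ Fin q → ℝ) : body V (odd V w) = 0 := by
  have : ExteriorAlgebra.algebraMapInv (ExteriorAlgebra.ι ℝ w) = 0 := by
    simp [ExteriorAlgebra.algebraMapInv]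
  rw [odd, body_tmul, this, zero_smul]

theorem isUnit_of_isUnit_body {f : SuperFun q V} (hf : par V f = f) (hb : IsUnit (body V f)) :
    IsUnit f := by
  let ι : smoothFun V →ₐ[ℝ] SuperFun q V := Algebra.TensorProduct.includeLeft
  let c₀ : smoothFun V →ₐ[ℝ] (isSuperComm : IsSuperComm (R := SuperFun q V) (par V)).even :=
    ι.codRestrict _ fun s => by
      change s ⊗ₜ CliffordAlgebra.involute (1 : Grass n q) = s ⊗ₜ[ℝ] (1 : Grass n q)
      rw [map_one]
  refine isSuperComm.isUnit_of_isUnit_body (c₀.comp (body V)) (Set.range fun s => s ⊗ₜ 1) (Set.range (odd V))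
    ?_ ?_ ?_ hf ?_
  · rintro _ ⟨s, rfl⟩
    change (body V (s ⊗ₜ[ℝ] (1 : Grass n q))) ⊗ₜ[ℝ] (1 : Grass n q) = s ⊗ₜ 1
    rw [body_tmul, map_one, one_smul]
  · rintro _ ⟨w, rfl⟩
    refine ⟨par_odd w, Subtype.ext ?_⟩
    change (body V (odd V w)) ⊗ₜ[ℝ] (1 : Grass n q) = 0
    rw [body_odd, TensorProduct.zero_tmul]
  · intro C hs ho hm ha f
    exact SuperFun.induction (fun s => hs _ ⟨s, rfl⟩) (fun w => ho _ ⟨w, rfl⟩) hm ha f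
  · exact hb.map c₀

theorem contract_gen (d : Module.Dual ℝ (Fin n ⊕ Fin q → ℝ)) (k : Fin n ⊕ Fin q) :
    (1 : smoothFun V) ⊗ₜ[ℝ] contract d (Grass.gen k) = d (Pi.single k 1) • 1 := by
  rw [Grass.gen, contract_ι, Algebra.algebraMap_eq_smul_one, TensorProduct.tmul_smul]
  rfl

/-- The coordinates and partial derivatives of a superdomain. -/
def frame (V : Opens (Fin n → ℝ)) : Frame n (R := SuperFun q V) (par V) (η V) where
  x := x V
  θ := θ V
  dx := dx V
  dθ := dθ V
  par_x i := by
    rw [x, par_tmul, map_one]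
  par_θ i := par_odd _
  dx_der := dx_der
  dθ_der := dθ_der
  dx_x i j := by
    rw [x, dx_tmul, smoothDeriv_coord]
    split_ifs
    · rfl
    · exact TensorProduct.zero_tmul _ _
  dx_θ i j := by
    rw [θ, dx_tmul, smoothDeriv_one, TensorProduct.zero_tmul]
  dx_η i j := by
    rw [η, dx_tmul, smoothDeriv_one, TensorProduct.zero_tmul]
  dθ_x i j := by
    rw [x, dθ_tmul]
    have := contract_algebraMap (LinearMap.proj (Sum.inl i) : (Fin n ⊕ Fin q → ℝ) →ₗ[ℝ] ℝ) 1
    rw [map_one] at this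
    rw [this, TensorProduct.tmul_zero]
  dθ_θ i j := by
    rw [θ, dθ_tmul, contract_gen, LinearMap.proj_apply]
    split_ifs with h
    · rw [h, Pi.single_eq_same, one_smul]
    · rw [Pi.single_eq_of_ne (fun h' => h (Sum.inl_injective h')), zero_smul]
  dθ_η i a := by
    rw [η, dθ_tmul, contract_gen, LinearMap.proj_apply, Pi.single_eq_of_ne (by simp), zero_smul]
  even_ext X hX hx hθ hη := der_eq_zero (AlgHom.id ℝ _) (fun _ => rfl) X hX.map_mul hx hθ hη
  odd_ext X hX hx hθ hη := der_eq_zero (par V) (fun s => by rw [par_tmul, map_one]) X hX.map_mul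
    hx hθ hη

end SuperFun

/-! ### Transport along isomorphisms -/

section Transport

variable {R R' : Type*} [Ring R] [Algebra ℝ R] [Ring R'] [Algebra ℝ R'] {α : R →ₐ[ℝ] R}
  {α' : R' →ₐ[ℝ] R'}

theorem IsSuperComm.transport (hS : IsSuperComm α') (φ : R ≃ₐ[ℝ] R')
    (hφ : ∀ f, φ (α f) = α' (φ f)) : IsSuperComm α where
  invol f := φ.injective (by rw [hφ, hφ, hS.invol])
  even_comm a f ha := φ.injective (by
    rw [map_mul, map_mul, hS.even_comm _ _ (by rw [← hφ, ha])])
  odd_anticomm a b ha hb := φ.injective (by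
    rw [map_mul, map_neg, map_mul,
      hS.odd_anticomm _ _ (by rw [← hφ, ha, map_neg]) (by rw [← hφ, hb, map_neg])])

/-- Conjugation of an operator by an isomorphism. -/
def conjOp (φ : R ≃ₐ[ℝ] R') (X : R' →ₗ[ℝ] R') : R →ₗ[ℝ] R :=
  φ.symm.toLinearMap ∘ₗ X ∘ₗ φ.toLinearMap

theorem conjOp_apply (φ : R ≃ₐ[ℝ] R') (X : R' →ₗ[ℝ] R') (f : R) :
    conjOp φ X f = φ.symm (X (φ f)) := rfl

theorem symm_par {φ : R ≃ₐ[ℝ] R'} (hφ : ∀ f, φ (α f) = α' (φ f)) (f : R') :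
    φ.symm (α' f) = α (φ.symm f) := by
  apply φ.injective
  rw [hφ, AlgEquiv.apply_symm_apply, AlgEquiv.apply_symm_apply]

theorem IsEvenDer.conj {φ : R ≃ₐ[ℝ] R'} (hφ : ∀ f, φ (α f) = α' (φ f)) {X : R' →ₗ[ℝ] R'}
    (hX : IsEvenDer α' X) : IsEvenDer α (conjOp φ X) where
  map_mul f g := by simp [conjOp_apply, hX.map_mul]
  map_par f := by rw [conjOp_apply, conjOp_apply, ← symm_par hφ, hX.map_par, hφ]

theorem IsOddDer.conj {φ : R ≃ₐ[ℝ] R'} (hφ : ∀ f, φ (α f) = α' (φ f)) {X : R' →ₗ[ℝ] R'}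
    (hX : IsOddDer α' X) : IsOddDer α (conjOp φ X) where
  map_mul f g := by simp [conjOp_apply, hX.map_mul, symm_par hφ]
  map_par f := by rw [conjOp_apply, conjOp_apply, ← symm_par hφ, hX.map_par, hφ, map_neg]

theorem conjOp_conjOp (φ : R ≃ₐ[ℝ] R') (X : R →ₗ[ℝ] R) : conjOp φ (conjOp φ.symm X) = X := by
  ext f
  simp [conjOp_apply]

/-- Transport of a coordinate frame along an isomorphism. -/
def Frame.transport {n q : ℕ} {η : Fin q → R} {η' : Fin q → R'} (F : Frame n α' η')
    (φ : R ≃ₐ[ℝ] R') (hφ : ∀ f, φ (α f) = α' (φ f)) (hη : ∀ a, φ (η a) = η' a) :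
    Frame n α η where
  x i := φ.symm (F.x i)
  θ i := φ.symm (F.θ i)
  dx i := conjOp φ (F.dx i)
  dθ i := conjOp φ (F.dθ i)
  par_x i := by rw [← symm_par hφ, F.par_x]
  par_θ i := by rw [← symm_par hφ, F.par_θ, map_neg]
  dx_der i := (F.dx_der i).conj hφ
  dθ_der i := (F.dθ_der i).conj hφ
  dx_x i j := by
    rw [conjOp_apply, AlgEquiv.apply_symm_apply, F.dx_x, apply_ite φ.symm, map_one, map_zero]
  dx_θ i j := by rw [conjOp_apply, AlgEquiv.apply_symm_apply, F.dx_θ, map_zero]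
  dx_η i a := by rw [conjOp_apply, hη, F.dx_η, map_zero]
  dθ_x i j := by rw [conjOp_apply, AlgEquiv.apply_symm_apply, F.dθ_x, map_zero]
  dθ_θ i j := by
    rw [conjOp_apply, AlgEquiv.apply_symm_apply, F.dθ_θ, apply_ite φ.symm, map_one, map_zero]
  dθ_η i a := by rw [conjOp_apply, hη, F.dθ_η, map_zero]
  even_ext X hX hx hθ h := by
    have e := F.even_ext (conjOp φ.symm X) (hX.conj (symm_par hφ))
      (fun i => (congrArg φ (hx i)).trans (map_zero φ))
      (fun i => (congrArg φ (hθ i)).trans (map_zero φ))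
      (fun a => by rw [conjOp_apply, ← hη, AlgEquiv.symm_apply_apply, h, map_zero])
    rw [← conjOp_conjOp φ X, e]
    ext f
    exact map_zero φ.symm
  odd_ext X hX hx hθ h := by
    have e := F.odd_ext (conjOp φ.symm X) (hX.conj (symm_par hφ))
      (fun i => (congrArg φ (hx i)).trans (map_zero φ))
      (fun i => (congrArg φ (hθ i)).trans (map_zero φ))
      (fun a => by rw [conjOp_apply, ← hη, AlgEquiv.symm_apply_apply, h, map_zero])
    rw [← conjOp_conjOp φ X, e]
    ext f
    exact map_zero φ.symm

end Transport

/-! ### Charts -/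

section

variable {R : Type*} [Ring R] [Algebra ℝ R] {α : R →ₐ[ℝ] R} {X : R →ₗ[ℝ] R}

/-- The Leibniz rule of an odd derivation on homogeneous elements, with the derivatives written to the
left as in the definition of the odd Poisson bracket. -/
theorem IsOddDer.of_homog (hS : IsSuperComm α)
    (h0 : ∀ g h, α g = g → (α h = h ∨ α h = -h) → X (g * h) = X g * h + X h * g)
    (h10 : ∀ g h, α g = -g → α h = h → X (g * h) = X g * h + X h * g)
    (h11 : ∀ g h, α g = -g → α h = -h → X (g * h) = X g * h - X h * g)
    (p0 : ∀ g, α g = g → α (X g) = -X g) (p1 : ∀ g, α g = -g → α (X g) = X g) :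
    IsOddDer α X where
  map_mul f g := by
    obtain ⟨a, b, ha, hb, rfl⟩ := hS.exists_even_odd f
    obtain ⟨c, d, hc, hd, rfl⟩ := hS.exists_even_odd g
    simp only [add_mul, mul_add, map_add, h0 a c ha (.inl hc), h0 a d ha (.inr hd), h10 b c hb hc,
      h11 b d hb hd, ha, hb]
    rw [hS.even_comm a _ ha, hS.even_comm a _ ha, hS.odd_anticomm _ b (p0 c hc) hb,
      hS.even_comm _ b (p1 d hd)]
    simp only [neg_mul]
    abel
  map_par f := by
    obtain ⟨a, b, ha, hb, rfl⟩ := hS.exists_even_odd f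
    simp only [map_add, ha, hb, p0 a ha, p1 b hb, map_neg]
    abel

/-- The Leibniz rule of an even derivation on homogeneous elements, with the derivatives written to
the left as in the definition of the odd Poisson bracket. -/
theorem IsEvenDer.of_homog (hS : IsSuperComm α)
    (h0 : ∀ g h, α g = g → (α h = h ∨ α h = -h) → X (g * h) = X g * h + X h * g)
    (h10 : ∀ g h, α g = -g → α h = h → X (g * h) = X g * h + X h * g)
    (h11 : ∀ g h, α g = -g → α h = -h → X (g * h) = X g * h - X h * g)
    (p0 : ∀ g, α g = g → α (X g) = X g) (p1 : ∀ g, α g = -g → α (X g) = -X g) :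
    IsEvenDer α X where
  map_mul f g := by
    obtain ⟨a, b, ha, hb, rfl⟩ := hS.exists_even_odd f
    obtain ⟨c, d, hc, hd, rfl⟩ := hS.exists_even_odd g
    simp only [add_mul, mul_add, map_add, h0 a c ha (.inl hc), h0 a d ha (.inr hd), h10 b c hb hc,
      h11 b d hb hd]
    rw [hS.even_comm a _ ha, hS.even_comm a _ ha, hS.even_comm _ b (p0 c hc),
      hS.odd_anticomm _ b (p1 d hd) hb]
    abel
  map_par f := by
    obtain ⟨a, b, ha, hb, rfl⟩ := hS.exists_even_odd f
    simp only [map_add, ha, hb, p0 a ha, p1 b hb, map_neg]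

/-- A derivation annihilates the even square roots of one. -/
theorem IsEvenDer.map_eq_zero_of_mul_self (hX : IsEvenDer α X) (hS : IsSuperComm α) {e : R}
    (he : α e = e) (h : e * e = 1) : X e = 0 := by
  have h1 : X e * e = 0 := by
    have := hX.map_mul e e
    rw [h, hX.map_one, hS.even_comm e _ he] at this
    refine eq_zero_of_eq_neg (eq_neg_of_add_eq_zero_left this.symm)
  calc X e = X e * e * e := by rw [mul_assoc, h, mul_one]
    _ = 0 := by rw [h1, zero_mul]

theorem IsOddDer.map_eq_zero_of_mul_self (hX : IsOddDer α X) (hS : IsSuperComm α) {e : R}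
    (he : α e = e) (h : e * e = 1) : X e = 0 := by
  have h1 : X e * e = 0 := by
    have := hX.map_mul e e
    rw [h, hX.map_one, he, hS.even_comm e _ he] at this
    refine eq_zero_of_eq_neg (eq_neg_of_add_eq_zero_left this.symm)
  calc X e = X e * e * e := by rw [mul_assoc, h, mul_one]
    _ = 0 := by rw [h1, zero_mul]

theorem Frame.lap_mul_of_mul_self {n q : ℕ} {η : Fin q → R} (F : Frame n α η) (hS : IsSuperComm α)
    {e : R} (he : α e = e) (h : e * e = 1) (s : R) : F.lap (e * s) = e * F.lap s := by
  simp_rw [F.lap_apply, (F.dθ_der _).map_mul, (F.dθ_der _).map_eq_zero_of_mul_self hS he h, he,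
    zero_mul, zero_add, (F.dx_der _).map_mul, (F.dx_der _).map_eq_zero_of_mul_self hS he h,
    zero_mul, zero_add, Finset.mul_sum]

end

variable {n q : ℕ} {M : Type u} [TopologicalSpace M]

namespace Chart

variable {X : SuperSpace.{u, v} q M} (c : Chart n X) {U W : Opens M}

theorem isSuperComm (h : U ≤ c.dom) : IsSuperComm (X.par U) :=
  SuperFun.isSuperComm.transport (c.iso U h) (c.iso_par U h)

/-- The coordinates and partial derivatives of a chart. -/
def frame (h : U ≤ c.dom) : Frame n (X.par U) (X.η U) :=
  (SuperFun.frame _).transport (c.iso U h) (c.iso_par U h) (c.iso_η U h)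

theorem frame_lap (h : U ≤ c.dom) : (c.frame h).lap = c.lap h := rfl

theorem res_symm (h : U ≤ c.dom) (k : W ≤ U) (f : SuperFun q (imageOpens c.homeo U)) :
    X.res k ((c.iso U h).symm f) =
      (c.iso W (k.trans h)).symm (SuperFun.res (imageOpens_mono c.homeo k) f) := by
  apply (c.iso W (k.trans h)).injective
  rw [AlgEquiv.apply_symm_apply]
  have := c.iso_res U W h k ((c.iso U h).symm f)
  rwa [AlgEquiv.apply_symm_apply] at this

theorem res_x (h : U ≤ c.dom) (k : W ≤ U) (i : Fin n) :
    X.res k (c.x h i) = c.x (k.trans h) i := by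
  rw [x, res_symm, SuperFun.res_x]
  rfl

theorem res_θ (h : U ≤ c.dom) (k : W ≤ U) (i : Fin n) :
    X.res k (c.θ h i) = c.θ (k.trans h) i := by
  rw [θ, res_symm, SuperFun.res_θ]
  rfl

theorem res_dx (h : U ≤ c.dom) (k : W ≤ U) (i : Fin n) (f : X.sec U) :
    X.res k (c.dx h i f) = c.dx (k.trans h) i (X.res k f) := by
  refine (c.res_symm h k _).trans ?_
  have e := (SuperFun.dx_res (imageOpens_mono c.homeo k) i (c.iso U h f)).symm
  rw [← c.iso_res U W h k f] at e
  exact congrArg (c.iso W (k.trans h)).symm e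

theorem res_dθ (h : U ≤ c.dom) (k : W ≤ U) (i : Fin n) (f : X.sec U) :
    X.res k (c.dθ h i f) = c.dθ (k.trans h) i (X.res k f) := by
  refine (c.res_symm h k _).trans ?_
  have e := (SuperFun.dθ_res (imageOpens_mono c.homeo k) i (c.iso U h f)).symm
  rw [← c.iso_res U W h k f] at e
  exact congrArg (c.iso W (k.trans h)).symm e

theorem res_lap (h : U ≤ c.dom) (k : W ≤ U) (f : X.sec U) :
    X.res k (c.lap h f) = c.lap (k.trans h) (X.res k f) := by
  simp [lap, res_dx, res_dθ]

theorem isUnit_of_isUnit_body (h : U ≤ c.dom) {f : X.sec U} (hf : X.par U f = f)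
    (hb : ∀ p, (SuperFun.body _ (c.iso U h f) : imageOpens c.homeo U → ℝ) p ≠ 0) : IsUnit f := by
  have e : IsUnit (c.iso U h f) := SuperFun.isUnit_of_isUnit_body
    (by rw [← c.iso_par U h, hf]) ((smooth_isUnit_iff _).mpr hb)
  have := e.map (c.iso U h).symm
  rwa [AlgEquiv.symm_apply_apply] at this

theorem body_ne_zero (h : U ≤ c.dom) {f : X.sec U} (hf : IsUnit f) (p : imageOpens c.homeo U) :
    (SuperFun.body _ (c.iso U h f) : imageOpens c.homeo U → ℝ) p ≠ 0 :=
  (smooth_isUnit_iff _).mp ((hf.map (c.iso U h)).map (SuperFun.body _)) p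

theorem isHomog_zero_iff {f : X.sec U} : X.IsHomog 0 f ↔ X.par U f = f := by
  rw [SuperSpace.IsHomog, pow_zero, one_mul]

theorem isHomog_one_iff {f : X.sec U} : X.IsHomog 1 f ↔ X.par U f = -f := by
  rw [SuperSpace.IsHomog, pow_one, neg_mul, one_mul]

/-- Even functions with positive body are determined by their squares. -/
theorem eq_of_isPos_of_mul_self_eq (h : U ≤ c.dom) {f g : X.sec U} (hf : c.IsPos h f)
    (hg : c.IsPos h g) (hfg : f * f = g * g) : f = g := by
  have pf := isHomog_zero_iff.mp hf.1
  have pg := isHomog_zero_iff.mp hg.1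
  have hu : IsUnit (f + g) := c.isUnit_of_isUnit_body h (by rw [map_add, pf, pg]) fun p => by
    rw [map_add, map_add]
    exact (add_pos (hf.2 p) (hg.2 p)).ne'
  refine sub_eq_zero.mp (hu.mul_right_eq_zero.mp ?_)
  rw [add_mul, mul_sub, mul_sub, hfg, (c.isSuperComm h).even_comm g f pg]
  abel

/-- An even unit differs from an even function with positive body by a locally constant sign. -/
theorem exists_sign (h : U ≤ c.dom) {g : X.sec U} (hg : X.par U g = g) (hu : IsUnit g) :
    ∃ e : X.sec U, X.par U e = e ∧ e * e = 1 ∧ c.IsPos h (e * g) := by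
  obtain ⟨ε, h1, h2⟩ := exists_smooth_sign _ (c.body_ne_zero h hu)
  have he : X.par U ((c.iso U h).symm (ε ⊗ₜ 1)) = (c.iso U h).symm (ε ⊗ₜ 1) := by
    have e := SuperFun.par_tmul (q := q) ε 1
    rw [map_one] at e
    refine (c.iso U h).injective ((c.iso_par U h _).trans ?_)
    exact (congrArg (SuperFun.par _) (AlgEquiv.apply_symm_apply _ _)).trans
      (e.trans (AlgEquiv.apply_symm_apply _ _).symm)
  refine ⟨(c.iso U h).symm (ε ⊗ₜ 1), he, ?_, ?_, fun p => ?_⟩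
  · rw [← map_mul, Algebra.TensorProduct.tmul_mul_tmul, h1, one_mul]
    exact map_one _
  · rw [isHomog_zero_iff, map_mul, he, hg]
  · rw [map_mul, AlgEquiv.apply_symm_apply, map_mul, SuperFun.body_tmul, map_one, one_smul]
    exact h2 p

end Chart

/-! ### The odd Poisson bracket -/

namespace OddSymplecticSupermanifold

variable (E : OddSymplecticSupermanifold.{u, v} n q M) {U : Opens M}

theorem br_der_of_even (hS : IsSuperComm (E.par U)) {f : E.sec U} (hf : E.par U f = f) :
    IsOddDer (E.par U) (E.br U f) := by
  have hf0 := Chart.isHomog_zero_iff.mpr hf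
  refine .of_homog hS ?_ ?_ ?_ ?_ ?_
  · rintro g h hg (hh | hh)
    · simpa using E.br_leibniz 0 0 0 f g h hf0 (Chart.isHomog_zero_iff.mpr hg)
        (Chart.isHomog_zero_iff.mpr hh)
    · simpa using E.br_leibniz 0 0 1 f g h hf0 (Chart.isHomog_zero_iff.mpr hg)
        (Chart.isHomog_one_iff.mpr hh)
  · intro g h hg hh
    simpa using E.br_leibniz 0 1 0 f g h hf0 (Chart.isHomog_one_iff.mpr hg)
      (Chart.isHomog_zero_iff.mpr hh)
  · intro g h hg hh
    simpa [sub_eq_add_neg] using E.br_leibniz 0 1 1 f g h hf0 (Chart.isHomog_one_iff.mpr hg)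
      (Chart.isHomog_one_iff.mpr hh)
  · intro g hg
    simpa [SuperSpace.IsHomog] using E.br_homog 0 0 f g hf0 (Chart.isHomog_zero_iff.mpr hg)
  · intro g hg
    simpa [SuperSpace.IsHomog] using E.br_homog 0 1 f g hf0 (Chart.isHomog_one_iff.mpr hg)

theorem br_der_of_odd (hS : IsSuperComm (E.par U)) {f : E.sec U} (hf : E.par U f = -f) :
    IsEvenDer (E.par U) (E.br U f) := by
  have hf1 := Chart.isHomog_one_iff.mpr hf
  refine .of_homog hS ?_ ?_ ?_ ?_ ?_
  · rintro g h hg (hh | hh)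
    · simpa using E.br_leibniz 1 0 0 f g h hf1 (Chart.isHomog_zero_iff.mpr hg)
        (Chart.isHomog_zero_iff.mpr hh)
    · simpa using E.br_leibniz 1 0 1 f g h hf1 (Chart.isHomog_zero_iff.mpr hg)
        (Chart.isHomog_one_iff.mpr hh)
  · intro g h hg hh
    simpa using E.br_leibniz 1 1 0 f g h hf1 (Chart.isHomog_one_iff.mpr hg)
      (Chart.isHomog_zero_iff.mpr hh)
  · intro g h hg hh
    simpa [sub_eq_add_neg] using E.br_leibniz 1 1 1 f g h hf1 (Chart.isHomog_one_iff.mpr hg)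
      (Chart.isHomog_one_iff.mpr hh)
  · intro g hg
    simpa [SuperSpace.IsHomog] using E.br_homog 1 0 f g hf1 (Chart.isHomog_zero_iff.mpr hg)
  · intro g hg
    simpa [SuperSpace.IsHomog, pow_succ] using E.br_homog 1 1 f g hf1
      (Chart.isHomog_one_iff.mpr hg)

theorem br_even_even {f g : E.sec U} (hf : E.par U f = f) (hg : E.par U g = g) :
    E.br U f g = E.br U g f := by
  simpa using E.br_skew 0 0 f g (Chart.isHomog_zero_iff.mpr hf) (Chart.isHomog_zero_iff.mpr hg)

theorem br_even_odd {f g : E.sec U} (hf : E.par U f = f) (hg : E.par U g = -g) :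
    E.br U f g = -E.br U g f := by
  simpa using E.br_skew 0 1 f g (Chart.isHomog_zero_iff.mpr hf) (Chart.isHomog_one_iff.mpr hg)

theorem br_odd_odd {f g : E.sec U} (hf : E.par U f = -f) (hg : E.par U g = -g) :
    E.br U f g = -E.br U g f := by
  simpa [pow_succ] using
    E.br_skew 1 1 f g (Chart.isHomog_one_iff.mpr hf) (Chart.isHomog_one_iff.mpr hg)

end OddSymplecticSupermanifold

namespace DarbouxChart

variable {E : OddSymplecticSupermanifold.{u, v} n q M} (c c' : DarbouxChart E) {U : Opens M}

theorem par_x (h : U ≤ c.dom) (i : Fin n) : E.par U (c.x h i) = c.x h i := (c.frame h).par_x i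

theorem par_θ (h : U ≤ c.dom) (i : Fin n) : E.par U (c.θ h i) = -c.θ h i := (c.frame h).par_θ i

theorem par_η (h : U ≤ c.dom) (a : Fin q) : E.par U (E.η U a) = -E.η U a := by
  refine (c.iso U h).injective ((c.iso_par U h _).trans ?_)
  refine Eq.trans ?_ (map_neg (c.iso U h) _).symm
  refine (congrArg (SuperFun.par _) (c.iso_η U h a)).trans (Eq.trans ?_
    (congrArg Neg.neg (c.iso_η U h a).symm))
  exact SuperFun.par_odd _

/-- In Darboux coordinates, the bracket with `xⁱ` is `∂/∂θᵢ`. -/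
theorem br_x (h : U ≤ c.dom) (i : Fin n) (f : E.sec U) : E.br U (c.x h i) f = c.dθ h i f := by
  have e := (c.frame h).odd_ext (E.br U (c.x h i) - c.dθ h i)
    ((E.br_der_of_even (c.isSuperComm h) (c.par_x h i)).sub ((c.frame h).dθ_der i))
    (fun j => by
      have h1 := congrArg (E.res h) (c.br_x_x i j)
      rw [E.br_res, c.res_x, c.res_x, map_zero] at h1
      exact (congrArg₂ (· - ·) h1 ((c.frame h).dθ_x i j)).trans (sub_zero _))
    (fun j => by
      have h1 := congrArg (E.res h) (c.br_x_θ i j)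
      rw [E.br_res, c.res_x, c.res_θ, apply_ite (E.res h), map_one, map_zero] at h1
      exact (congrArg₂ (· - ·) h1 ((c.frame h).dθ_θ i j)).trans (sub_self _))
    (fun a => by
      have h1 : E.br U (c.x h i) (E.η U a) = 0 := by
        rw [E.br_even_odd (c.par_x h i) (c.par_η h a), E.br_η, neg_zero]
      exact (congrArg₂ (· - ·) h1 ((c.frame h).dθ_η i a)).trans (sub_zero _))
  exact sub_eq_zero.mp (LinearMap.congr_fun e f)

/-- In Darboux coordinates, the bracket with `θᵢ` is `-∂/∂xⁱ`. -/
theorem br_θ (h : U ≤ c.dom) (i : Fin n) (f : E.sec U) : E.br U (c.θ h i) f = -c.dx h i f := by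
  have e := (c.frame h).even_ext (E.br U (c.θ h i) + c.dx h i)
    ((E.br_der_of_odd (c.isSuperComm h) (c.par_θ h i)).add ((c.frame h).dx_der i))
    (fun j => by
      have h1 : E.br U (c.θ h i) (c.x h j) = -(if i = j then 1 else 0) := by
        rw [eq_neg_iff_add_eq_zero, add_comm, ← eq_neg_iff_add_eq_zero,
          ← E.br_even_odd (c.par_x h j) (c.par_θ h i), c.br_x h j]
        refine Eq.trans ?_ ((c.frame h).dθ_θ j i).symm
        simp only [eq_comm]
      exact (congrArg₂ (· + ·) h1 ((c.frame h).dx_x i j)).trans (neg_add_cancel _))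
    (fun j => by
      have h1 := congrArg (E.res h) (c.br_θ_θ i j)
      rw [E.br_res, c.res_θ, c.res_θ, map_zero] at h1
      exact (congrArg₂ (· + ·) h1 ((c.frame h).dx_θ i j)).trans (add_zero _))
    (fun a => by
      have h1 : E.br U (c.θ h i) (E.η U a) = 0 := by
        rw [E.br_odd_odd (c.par_θ h i) (c.par_η h a), E.br_η, neg_zero]
      exact (congrArg₂ (· + ·) h1 ((c.frame h).dx_η i a)).trans (add_zero _))
  exact eq_neg_of_add_eq_zero_left (LinearMap.congr_fun e f)

/-- Each relation is the skew-symmetry of the bracket of two coordinates, one from each chart. -/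
theorem darbouxRel (h : U ≤ c.dom) (h' : U ≤ c'.dom) :
    Frame.DarbouxRel (c.frame h) (c'.frame h') where
  dx_x j k := by
    change c.dx h j (c'.x h' k) = c'.dθ h' k (c.θ h j)
    rw [← c'.br_x, E.br_even_odd (c'.par_x h' k) (c.par_θ h j), c.br_θ, neg_neg]
  dθ_x i k := by
    change c.dθ h i (c'.x h' k) = c'.dθ h' k (c.x h i)
    rw [← c'.br_x, E.br_even_even (c'.par_x h' k) (c.par_x h i), c.br_x]
  dθ_θ i k := by
    change c.dθ h i (c'.θ h' k) = c'.dx h' k (c.x h i)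
    rw [← c.br_x, E.br_even_odd (c.par_x h i) (c'.par_θ h' k), c'.br_θ, neg_neg]
  dx_θ i k := by
    change c.dx h i (c'.θ h' k) = -c'.dx h' k (c.θ h i)
    rw [← c'.br_θ, E.br_odd_odd (c'.par_θ h' k) (c.par_θ h i), c.br_θ, neg_neg]

/-- The positive square root of the Berezinian is `g = det (∂x'ᵏ/∂xʲ)⁻¹` multiplied by the sign of the
body of `g`. -/
theorem exists_isSqrtBer (h : U ≤ c.dom) (h' : U ≤ c'.dom) :
    ∃ r : E.sec U, c.IsSqrtBer c'.toChart h h' r ∧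
      ∀ s : E.sec U, c.lap h s * r = c'.lap h' (s * r) := by
  have hS := c.isSuperComm h
  have hr := c.darbouxRel c' h h'
  obtain ⟨e, he, hee, hpos⟩ := c.exists_sign h (hr.G hS).det.2 (hr.isUnit_det hS)
  generalize hg : ((hr.G hS).det : E.sec U) = g at *
  have hgp : E.par U g = g := hg ▸ (hr.G hS).det.2
  refine ⟨e * g, ⟨hpos, ?_⟩, fun s => ?_⟩
  · have hb := hr.ber_eq hS
    rw [hg] at hb
    calc e * g * (e * g) = e * e * (g * g) := by
          rw [mul_assoc, mul_assoc, ← mul_assoc g, hS.even_comm g e hgp, mul_assoc]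
      _ = g * g := by rw [hee, one_mul]
      _ = _ := hb.symm
  · have h1 := hr.lap'_det_mul hS (e * s)
    rw [(c.frame h).lap_mul_of_mul_self hS he hee, hg, c.frame_lap, c'.frame_lap] at h1
    have h2 : s * (e * g) = g * (e * s) := by
      rw [← mul_assoc, hS.even_comm g _ hgp, hS.even_comm e s he]
    rw [h2, h1, hS.even_comm g _ hgp, hS.even_comm e (c.lap h s) he, mul_assoc]

theorem existsUnique_isSqrtBer (h : U ≤ c.dom) (h' : U ≤ c'.dom) :
    ∃! r : E.sec U, c.IsSqrtBer c'.toChart h h' r := by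
  obtain ⟨r, hr, -⟩ := c.exists_isSqrtBer c' h h'
  exact ⟨r, hr, fun r' hr' => c.eq_of_isPos_of_mul_self_eq h hr'.1 hr.1 (hr'.2.trans hr.2.symm)⟩

theorem lap_mul_sqrtBer (h : U ≤ c.dom) (h' : U ≤ c'.dom) (s : E.sec U) :
    c.lap h s * c.sqrtBer c'.toChart h h' = c'.lap h' (s * c.sqrtBer c'.toChart h h') := by
  obtain ⟨r, hr, hs⟩ := c.exists_isSqrtBer c' h h'
  have e : c.sqrtBer c'.toChart h h' = r :=
    (c.existsUnique_isSqrtBer c' h h').unique (Classical.epsilon_spec ⟨r, hr⟩) hr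
  rw [e, hs]

end DarbouxChart

/-! ### The canonical operator on semidensities -/

/-- The canonical odd Laplacian on semidensities, given in each Darboux chart by the coordinate
Laplacian of the coefficient. -/
def semidensityLap (E : OddSymplecticSupermanifold.{u, v} n q M) :
    Semidensity E →ₗ[ℝ] Semidensity E where
  toFun s := ⟨fun c => c.lap le_rfl (s.1 c), fun c c' => by
    rw [c.res_lap, c'.res_lap, s.2 c c', ← c.lap_mul_sqrtBer c']⟩
  map_add' s t := Subtype.ext (funext fun c => map_add (c.lap le_rfl) _ _)
  map_smul' r s := Subtype.ext (funext fun c => map_smul (c.lap le_rfl) _ _)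

end OddSymp

end

theorem mainTheorem2 {n q : ℕ} {M : Type u} [TopologicalSpace M] [T2Space M]
    [SecondCountableTopology M] (E : OddSymp.OddSymplecticSupermanifold.{u, v} n q M) :
    -- invariance of the local formula under a change of Darboux coordinates
    (∀ (c c' : OddSymp.DarbouxChart E) (U : Opens M) (h : U ≤ c.dom) (h' : U ≤ c'.dom),
      (∃! r : E.sec U, c.IsSqrtBer c'.toChart h h' r) ∧
      ∀ s : E.sec U, c.lap h s * c.sqrtBer c'.toChart h h' =
        c'.lap h' (s * c.sqrtBer c'.toChart h h')) ∧
    -- the canonical operator on semidensities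
    ∃ Δ : OddSymp.Semidensity E →ₗ[ℝ] OddSymp.Semidensity E,
      (∀ (s : OddSymp.Semidensity E) (c : OddSymp.DarbouxChart E),
        (Δ s).1 c = c.lap le_rfl (s.1 c)) ∧
      (∀ Δ' : OddSymp.Semidensity E → OddSymp.Semidensity E,
        (∀ (s : OddSymp.Semidensity E) (c : OddSymp.DarbouxChart E),
          (Δ' s).1 c = c.lap le_rfl (s.1 c)) → Δ' = Δ) ∧
      Δ ∘ₗ Δ = 0 := by
  refine ⟨fun c c' U h h' => ⟨c.existsUnique_isSqrtBer c' h h', c.lap_mul_sqrtBer c' h h'⟩,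
    OddSymp.semidensityLap E, fun s c => rfl, fun Δ' hΔ' => ?_, ?_⟩
  · exact funext fun s => Subtype.ext (funext fun c => hΔ' s c)
  · exact LinearMap.ext fun s => Subtype.ext (funext fun c =>
      (c.frame le_rfl).lap_lap (c.isSuperComm le_rfl) (s.1 c))
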